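/- Let $d\ge 1$ be an integer, $\alpha\in(0,2)$ and $\varepsilon>0$. For a measurable $V:\mathbb R^d\to\mathbb R$ with $\int_{\mathbb R^d} e^{-V(x)}\,dx<\infty$, let $\mu_V(dx)=\big(\int_{\mathbb R^d} e^{-V(y)}\,dy\big)^{-1}e^{-V(x)}\,dx$, write $\mu_V(f)=\int f\,d\mu_V$, and let $$\mathcal E_{\alpha,V}(f,g)=\iint_{\mathbb R^d\times\mathbb R^d}\frac{(f(x)-f(y))(g(x)-g(y))}{|x-y|^{d+\alpha}}\,dy\,\mu_V(dx),\qquad \mathcal D(\mathcal E_{\alpha,V})=\{f\in L^2(\mu_V):\ \mathcal E_{\alpha,V}(f,f)<\infty\}.$$ For a function $\beta:(0,\infty)\to(0,\infty)$, the super Poincaré inequality with rate $\beta$ is $$\mu_V(f^2)\le r\,\mathcal E_{\alpha,V}(f,f)+\beta(r)\,\mu_V(|f|)^2\qquad\text{for all } r>0,\ f\in\mathcal D(\mathcal E_{\alpha,V}).\tag{SP}$$ Let $(P_t^{\alpha,V})_{t\ge0}$ be the Markov semigroup on $L^2(\mu_V)$ associated with $(\mathcal E_{\alpha,V},\mathcal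 D(\mathcal E_{\alpha,V}))$, i.e. the symmetric, strongly continuous contraction semigroup preserving positivity and constants whose generator $L$ is given by: $u\in\mathcal D(L)$ and $Lu=g$ if and only if $u\in\mathcal D(\mathcal E_{\alpha,V})$ and $\mathcal E_{\alpha,V}(u,v)=-\mu_V(gv)$ for all $v\in\mathcal D(\mathcal E_{\alpha,V})$. (1) Let $V(x)=\log^{1+\varepsilon}(1+|x|^2)$. Then $\mu_V$ is a probability measure, the semigroup $P_t^{\alpha,V}$ exists and is unique, and there is a constant $c>0$ such that (SP) holds for $$\beta(r)=c+c\,r^{-2(\alpha+d)/\alpha}\exp\big[c\log^{1/(1+\varepsilon)}(1+r^{-1})\big],\qquad r>0.$$ Moreover, there is a constant $\lambda>0$ such that $$\|P_t^{\alpha,V}\|_{L^1(\mu_V)\to L^\infty(\mu_V)}\le\lambda+\lambda\,t^{-2(\alpha+d)/\alpha}\exp\big[\lambda\log^{1/(1+\varepsilon)}(1+t^{-1})\big],\qquad t>0.$$ (2) Let $V(x)=(1+|x|^2)^{\varepsilon}$. Then $\mu_V$ is a probability measure, the semigroup $P_t^{\alpha,V}$ exists and is unique, and there is a constant $c>0$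 such that (SP) holds for $$\beta(r)=c\Big(1+r^{-2(\alpha+d)/\alpha}\log^{(2\alpha+d)(d+\alpha)/(2\varepsilon\alpha)}(1+r^{-1})\Big),\qquad r>0.$$ Moreover, there is a constant $\lambda>0$ such that $$\|P_t^{\alpha,V}\|_{L^1(\mu_V)\to L^\infty(\mu_V)}\le\lambda\Big(1+t^{-2(\alpha+d)/\alpha}\log^{(2\alpha+d)(d+\alpha)/(2\varepsilon\alpha)}(1+t^{-1})\Big),\qquad t>0.$$ All constants may depend on $d$, $\alpha$ and $\varepsilon$. -/

import Mathlib

open MeasureTheory Filter Topology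
open scoped NNReal ENNReal

noncomputable section

namespace StableLike

/-- The probability measure `μ_V(dx) = (∫ e^{-V(x)} dx)⁻¹ e^{-V(x)} dx` on `ℝ^d`
(for `V` measurable with `e^{-V}` integrable). -/
def gibbs {d : ℕ} (V : EuclideanSpace ℝ (Fin d) → ℝ) : Measure (EuclideanSpace ℝ (Fin d)) :=
  (∫⁻ x, ENNReal.ofReal (Real.exp (-V x)))⁻¹ •
    (volume : Measure (EuclideanSpace ℝ (Fin d))).withDensity
      (fun x => ENNReal.ofReal (Real.exp (-V x)))

/-- The integrand `(f(x) - f(y)) (g(x) - g(y)) / |x - y|^{d + α}` at `(x, y)`. -/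
def kernel {d : ℕ} (α : ℝ) (f g : EuclideanSpace ℝ (Fin d) → ℝ)
    (p : EuclideanSpace ℝ (Fin d) × EuclideanSpace ℝ (Fin d)) : ℝ :=
  (f p.1 - f p.2) * (g p.1 - g p.2) / ‖p.1 - p.2‖ ^ ((d : ℝ) + α)

/-- The domain: those `f ∈ L²(μ_V)` with `E_{α,V}(f, f) < ∞`. As the integrand of
`E_{α,V}(f, f)` is nonnegative and measurable, finiteness is integrability
with respect to `μ_V(dx) dy`. -/
def formDomain {d : ℕ} (α : ℝ) (V : EuclideanSpace ℝ (Fin d) → ℝ) : Set (Lp ℝ 2 (gibbs V)) :=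
  {f | Integrable (kernel α f f) ((gibbs V).prod volume)}

/-- The form
`E_{α,V}(f, g) = ∬ (f(x) - f(y)) (g(x) - g(y)) / |x - y|^{d + α} dy μ_V(dx)`.
For `f` and `g` in the domain the integral converges absolutely (Cauchy-Schwarz). -/
def form {d : ℕ} (α : ℝ) (V : EuclideanSpace ℝ (Fin d) → ℝ) (f g : Lp ℝ 2 (gibbs V)) : ℝ :=
  ∫ p, kernel α f g p ∂((gibbs V).prod volume)

/-- The super Poincaré inequality
`μ_V(f²) ≤ r E_{α,V}(f, f) + β(r) μ_V(|f|)²` for all `r > 0` and all `f` in the domain. -/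
def SuperPoincare {d : ℕ} (α : ℝ) (V : EuclideanSpace ℝ (Fin d) → ℝ) (β : ℝ → ℝ) : Prop :=
  ∀ r : ℝ, 0 < r → ∀ f ∈ formDomain α V,
    ∫ x, f x ^ 2 ∂(gibbs V) ≤ r * form α V f f + β r * (∫ x, |f x| ∂(gibbs V)) ^ 2

/-- `P` is the Markov semigroup on `L²(μ_V)` associated with the form `E_{α,V}`: a strongly
continuous contraction semigroup of symmetric operators that preserves positivity and constants,
and whose generator `L` (the strong derivative at `t = 0`, with its exact domain) is the operator
of the form, that is, `u ∈ D(L)` and `L u = g` if and only if `u` belongs to the domain of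
the form and `E_{α,V}(u, v) = -⟨g, v⟩` for all `v` in the domain of the form. -/
structure IsAssociatedSemigroup {d : ℕ} (α : ℝ) (V : EuclideanSpace ℝ (Fin d) → ℝ)
    (P : ℝ≥0 → Lp ℝ 2 (gibbs V) →L[ℝ] Lp ℝ 2 (gibbs V)) : Prop where
  map_zero : P 0 = ContinuousLinearMap.id ℝ _
  map_add : ∀ s t, P (s + t) = (P s).comp (P t)
  continuous : ∀ f, Continuous fun t => P t f
  contraction : ∀ t, ‖P t‖ ≤ 1
  symmetric : ∀ t f g, inner ℝ (P t f) g = inner ℝ f (P t g)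
  positive : ∀ t f, (∀ᵐ x ∂(gibbs V), 0 ≤ f x) → ∀ᵐ x ∂(gibbs V), 0 ≤ P t f x
  map_one : ∀ t f, (∀ᵐ x ∂(gibbs V), f x = 1) → ∀ᵐ x ∂(gibbs V), P t f x = 1
  generator : ∀ u g : Lp ℝ 2 (gibbs V),
    Tendsto (fun t : ℝ≥0 => (t : ℝ)⁻¹ • (P t u - u)) (𝓝[>] 0) (𝓝 g) ↔
      u ∈ formDomain α V ∧ ∀ v ∈ formDomain α V, form α V u v = -inner ℝ g v

/-- The norm `‖T‖_{L¹(μ) → L^∞(μ)} ∈ [0, ∞]` of an operator `T` on `L²(μ)`: the supremum of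
`‖T f‖_∞` over `f ∈ L²(μ)` with `‖f‖₁ ≤ 1`. (For a finite measure `μ`, `L²(μ)` is dense
in `L¹(μ)`.) -/
def normL1Linf {X : Type*} [MeasurableSpace X] {μ : Measure X}
    (T : Lp ℝ 2 μ →L[ℝ] Lp ℝ 2 μ) : ℝ≥0∞ :=
  ⨆ (f : Lp ℝ 2 μ) (_ : eLpNorm f 1 μ ≤ 1), eLpNorm (T f) ∞ μ

/-- `V(x) = log^{1+ε}(1 + |x|²)`. -/
def logPotential (d : ℕ) (ε : ℝ) (x : EuclideanSpace ℝ (Fin d)) : ℝ :=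
  Real.log (1 + ‖x‖ ^ 2) ^ (1 + ε)

/-- `V(x) = (1 + |x|²)^ε`. -/
def powPotential (d : ℕ) (ε : ℝ) (x : EuclideanSpace ℝ (Fin d)) : ℝ :=
  (1 + ‖x‖ ^ 2) ^ ε

/-- `β(r) = c + c r^{-2(α+d)/α} exp[c log^{1/(1+ε)}(1 + 1/r)]`. -/
def logRate (d : ℕ) (α ε c r : ℝ) : ℝ :=
  c + c * r ^ (-(2 * (α + d) / α)) * Real.exp (c * Real.log (1 + r⁻¹) ^ (1 / (1 + ε)))

/-- `β(r) = c (1 + r^{-2(α+d)/α} log^{(2α+d)(d+α)/(2εα)}(1 + 1/r))`. -/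
def powRate (d : ℕ) (α ε c r : ℝ) : ℝ :=
  c * (1 + r ^ (-(2 * (α + d) / α)) *
    Real.log (1 + r⁻¹) ^ ((2 * α + d) * (d + α) / (2 * ε * α)))

end StableLike

end

namespace LinearPMap

variable {H K : Type*} [NormedAddCommGroup H] [InnerProductSpace ℝ H]
  [NormedAddCommGroup K] [InnerProductSpace ℝ K]

/-- `T.FormGenerator u g` says that `u` lies in the domain of the operator `L = -T* T` of the
form `(u, v) ↦ ⟪T u, T v⟫`, and that `L u = g`. -/
def FormGenerator (T : H →ₗ.[ℝ] K) (u g : H) : Prop :=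
  ∃ h : u ∈ T.domain, ∀ v : T.domain, inner ℝ (T ⟨u, h⟩) (T v) = -inner ℝ g (v : H)

namespace FormGenerator

variable {T : H →ₗ.[ℝ] K}

theorem add {u g v h : H} (hu : T.FormGenerator u g) (hv : T.FormGenerator v h) :
    T.FormGenerator (u + v) (g + h) := by
  obtain ⟨a, ha⟩ := hu
  obtain ⟨b, hb⟩ := hv
  refine ⟨T.domain.add_mem a b, fun w => ?_⟩
  have : (⟨u + v, T.domain.add_mem a b⟩ : T.domain) = ⟨u, a⟩ + ⟨v, b⟩ := rfl
  rw [this, T.map_add, inner_add_left, ha, hb, inner_add_left]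
  ring

theorem smul {u g : H} (c : ℝ) (hu : T.FormGenerator u g) :
    T.FormGenerator (c • u) (c • g) := by
  obtain ⟨a, ha⟩ := hu
  refine ⟨T.domain.smul_mem c a, fun w => ?_⟩
  have : (⟨c • u, T.domain.smul_mem c a⟩ : T.domain) = c • ⟨u, a⟩ := rfl
  rw [this, T.map_smul, inner_smul_left, ha, inner_smul_left]
  simp

theorem neg {u g : H} (hu : T.FormGenerator u g) : T.FormGenerator (-u) (-g) := by
  simpa using hu.smul (-1)

theorem sub {u g v h : H} (hu : T.FormGenerator u g) (hv : T.FormGenerator v h) :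
    T.FormGenerator (u - v) (g - h) := by
  simpa only [sub_eq_add_neg] using hu.add hv.neg

theorem inner_self_eq {u g : H} (hu : T.FormGenerator u g) :
    inner ℝ g u = -‖T ⟨u, hu.1⟩‖ ^ 2 := by
  have := hu.2 ⟨u, hu.1⟩
  rw [real_inner_self_eq_norm_sq] at this
  linarith

theorem inner_self_nonpos {u g : H} (hu : T.FormGenerator u g) : inner ℝ g u ≤ 0 := by
  rw [hu.inner_self_eq]
  have := sq_nonneg ‖T ⟨u, hu.1⟩‖
  linarith

theorem symm {u g v h : H} (hu : T.FormGenerator u g) (hv : T.FormGenerator v h) :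
    inner ℝ g v = inner ℝ u h := by
  have h1 := hu.2 ⟨v, hv.1⟩
  have h2 := hv.2 ⟨u, hu.1⟩
  rw [real_inner_comm] at h2
  rw [real_inner_comm h u]
  simp only at h1 h2
  linarith

theorem eq_of_smul_sub {c : ℝ} (hc : 0 < c) {f u v : H} (hu : T.FormGenerator u (c • (u - f)))
    (hv : T.FormGenerator v (c • (v - f))) : u = v := by
  have h := (hu.sub hv).inner_self_nonpos
  have e : c • (u - f) - c • (v - f) = c • (u - v) := by
    rw [← smul_sub]; congr 1; abel
  rw [e, inner_smul_left, real_inner_self_eq_norm_sq] at h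
  simp only [conj_trivial] at h
  have h2 : ‖u - v‖ ^ 2 ≤ 0 := by
    by_contra! h3
    have := mul_pos hc h3
    linarith
  have h3 : ‖u - v‖ = 0 := by
    have := sq_nonneg ‖u - v‖
    exact pow_eq_zero_iff (two_ne_zero) |>.1 (le_antisymm h2 this)
  exact sub_eq_zero.1 (norm_eq_zero.1 h3)

end FormGenerator

theorem exists_formResolvent_one [CompleteSpace H] [CompleteSpace K] (T : H →ₗ.[ℝ] K)
    (hT : T.IsClosed) :
    ∃ R : H →L[ℝ] H, ∀ f, T.FormGenerator (R f) (R f - f) := by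
  let e : WithLp 2 (H × K) ≃L[ℝ] H × K := WithLp.prodContinuousLinearEquiv 2 ℝ H K
  let Γ : Submodule ℝ (WithLp 2 (H × K)) := T.graph.comap (e : WithLp 2 (H × K) →ₗ[ℝ] H × K)
  have hΓ : _root_.IsClosed (Γ : Set (WithLp 2 (H × K))) := hT.preimage e.continuous
  have : CompleteSpace Γ := hΓ.completeSpace_coe
  let ι : H →L[ℝ] WithLp 2 (H × K) :=
    (e.symm : H × K →L[ℝ] WithLp 2 (H × K)).comp (ContinuousLinearMap.inl ℝ H K)
  let R : H →L[ℝ] H := (WithLp.fstL 2 ℝ H K).comp (Γ.starProjection.comp ι)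
  refine ⟨R, fun f => ?_⟩
  have hmem : Γ.starProjection (ι f) ∈ Γ := Γ.starProjection_apply_mem _
  obtain ⟨y, hy1, hy2⟩ := (LinearPMap.mem_graph_iff T).1 (show e _ ∈ T.graph from hmem)
  have hR : (y : H) = R f := hy1
  refine ⟨hR ▸ y.2, fun v => ?_⟩
  have hv : e.symm ((v : H), T v) ∈ Γ := by
    change e _ ∈ T.graph
    rw [e.apply_symm_apply]
    exact T.mem_graph v
  have h0 := Submodule.starProjection_inner_eq_zero (K := Γ) (ι f) _ hv
  rw [WithLp.prod_inner_apply] at h0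
  have hyy : (⟨R f, hR ▸ y.2⟩ : T.domain) = y := Subtype.ext hR.symm
  rw [hyy, hy2]
  have h1 : inner ℝ (f - R f) (v : H) +
      inner ℝ (0 - (e (Γ.starProjection (ι f))).2) (T v) = 0 := h0
  rw [zero_sub, inner_neg_left, inner_sub_left] at h1
  rw [inner_sub_left]
  linarith

theorem IsClosed.smul {T : H →ₗ.[ℝ] K} (hT : T.IsClosed) {c : ℝ} (hc : c ≠ 0) :
    (c • T).IsClosed := by
  have : ((c • T).graph : Set (H × K)) = (fun p : H × K => (p.1, c⁻¹ • p.2)) ⁻¹' T.graph := by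
    ext p
    simp only [SetLike.mem_coe, LinearPMap.mem_graph_iff, Set.mem_preimage]
    constructor
    · rintro ⟨y, h1, h2⟩
      refine ⟨y, h1, ?_⟩
      rw [← h2, LinearPMap.smul_apply, smul_smul, inv_mul_cancel₀ hc, one_smul]
    · rintro ⟨y, h1, h2⟩
      refine ⟨y, h1, ?_⟩
      rw [LinearPMap.smul_apply, h2, smul_smul, mul_inv_cancel₀ hc, one_smul]
  rw [LinearPMap.IsClosed, this]
  exact IsClosed.preimage (by fun_prop) hT

theorem exists_formResolvent [CompleteSpace H] [CompleteSpace K] (T : H →ₗ.[ℝ] K)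
    (hT : T.IsClosed) {c : ℝ} (hc : 0 < c) :
    ∃ R : H →L[ℝ] H, ∀ f, T.FormGenerator (R f) (c • (R f - f)) := by
  have hs : (Real.sqrt c)⁻¹ ≠ 0 := by positivity
  obtain ⟨R, hR⟩ := exists_formResolvent_one ((Real.sqrt c)⁻¹ • T) (hT.smul hs)
  refine ⟨R, fun f => ?_⟩
  obtain ⟨h, hv⟩ := hR f
  refine ⟨h, fun v => ?_⟩
  have := hv v
  rw [LinearPMap.smul_apply, LinearPMap.smul_apply, inner_smul_left, inner_smul_right,
    ← mul_assoc] at this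
  simp only [conj_trivial] at this
  rw [← mul_inv, Real.mul_self_sqrt hc.le] at this
  rw [inner_smul_left, conj_trivial]
  field_simp at this
  exact this

/-- The resolvent `c (c - L)⁻¹` of the operator `L` of a closed form. -/
noncomputable def formResolvent [CompleteSpace H] [CompleteSpace K] (T : H →ₗ.[ℝ] K)
    (hT : T.IsClosed) (c : ℝ) : H →L[ℝ] H :=
  if hc : 0 < c then (exists_formResolvent T hT hc).choose else 0

section Resolvent

variable [CompleteSpace H] [CompleteSpace K] {T : H →ₗ.[ℝ] K} (hT : T.IsClosed)
include hT

theorem formGenerator_formResolvent {c : ℝ} (hc : 0 < c) (f : H) :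
    T.FormGenerator (T.formResolvent hT c f) (c • (T.formResolvent hT c f - f)) := by
  rw [formResolvent, dif_pos hc]
  exact (exists_formResolvent T hT hc).choose_spec f

theorem formResolvent_eq {c : ℝ} (hc : 0 < c) {f u : H}
    (hu : T.FormGenerator u (c • (u - f))) : T.formResolvent hT c f = u :=
  (formGenerator_formResolvent hT hc f).eq_of_smul_sub hc hu

theorem norm_formResolvent_apply_le {c : ℝ} (hc : 0 < c) (f : H) :
    ‖T.formResolvent hT c f‖ ≤ ‖f‖ := by
  have h := (formGenerator_formResolvent hT hc f).inner_self_nonpos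
  rw [inner_smul_left, conj_trivial, inner_sub_left, real_inner_self_eq_norm_sq] at h
  set u := T.formResolvent hT c f
  have h1 : ‖u‖ ^ 2 ≤ inner ℝ f u := by
    by_contra! h3
    have := mul_pos hc (sub_pos.2 h3)
    linarith
  have h2 := real_inner_le_norm f u
  by_contra! h3
  have h4 : 0 < ‖u‖ := (norm_nonneg f).trans_lt h3
  nlinarith

theorem norm_formResolvent_le {c : ℝ} (hc : 0 < c) : ‖T.formResolvent hT c‖ ≤ 1 :=
  ContinuousLinearMap.opNorm_le_bound _ zero_le_one fun f => by
    simpa using norm_formResolvent_apply_le hT hc f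

theorem inner_formResolvent {c : ℝ} (hc : 0 < c) (f g : H) :
    inner ℝ (T.formResolvent hT c f) g = inner ℝ f (T.formResolvent hT c g) := by
  have h := (formGenerator_formResolvent hT hc f).symm (formGenerator_formResolvent hT hc g)
  rw [inner_smul_left, inner_smul_right, conj_trivial, inner_sub_left, inner_sub_right] at h
  have := mul_left_cancel₀ hc.ne' h
  linarith

theorem FormGenerator.formResolvent_apply {u g : H} (hu : T.FormGenerator u g) {c : ℝ}
    (hc : 0 < c) : c • (T.formResolvent hT c u - u) = T.formResolvent hT c g := by
  have h := hu.add ((formGenerator_formResolvent hT hc g).smul c⁻¹)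
  rw [smul_smul, inv_mul_cancel₀ hc.ne', one_smul, add_sub_cancel] at h
  have e : T.formResolvent hT c g =
      c • (u + c⁻¹ • T.formResolvent hT c g - u) := by
    rw [add_sub_cancel_left, smul_smul, mul_inv_cancel₀ hc.ne', one_smul]
  nth_rewrite 2 [e] at h
  rw [formResolvent_eq hT hc h, ← e]

theorem formResolvent_commute {a b : ℝ} (ha : 0 < a) (hb : 0 < b) :
    Commute (T.formResolvent hT a) (T.formResolvent hT b) := by
  rcases eq_or_ne a b with rfl | hab
  · exact Commute.refl _
  refine ContinuousLinearMap.ext fun f => ?_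
  change T.formResolvent hT a (T.formResolvent hT b f) =
    T.formResolvent hT b (T.formResolvent hT a f)
  have h1 := (formGenerator_formResolvent hT hb f).formResolvent_apply hT ha
  have h2 := (formGenerator_formResolvent hT ha f).formResolvent_apply hT hb
  rw [_root_.map_smul, _root_.map_sub] at h1 h2
  set x := T.formResolvent hT a (T.formResolvent hT b f)
  set y := T.formResolvent hT b (T.formResolvent hT a f)
  have h3 : (a - b) • (x - y) = 0 := by
    have : (a - b) • (x - y) = (a • (x - T.formResolvent hT b f) -
      b • (x - T.formResolvent hT a f)) +
      (b • (y - T.formResolvent hT a f) - a • (y - T.formResolvent hT b f)) := by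
      module
    rw [this, h1, h2]
    simp
  exact sub_eq_zero.1 ((smul_eq_zero.1 h3).resolve_left (sub_ne_zero.2 hab))

theorem norm_formResolvent_sub_sq_le {c : ℝ} (hc : 0 < c) (f : T.domain) :
    c * ‖T.formResolvent hT c f - f‖ ^ 2 ≤ ‖T f‖ ^ 2 := by
  obtain ⟨h, hv⟩ := formGenerator_formResolvent hT hc (f : H)
  generalize T.formResolvent hT c f = u at h hv ⊢
  have h1 := hv (⟨u, h⟩ - f)
  rw [T.map_sub, inner_sub_right, inner_smul_left, conj_trivial] at h1
  rw [real_inner_self_eq_norm_sq, Submodule.coe_sub, real_inner_self_eq_norm_sq] at h1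
  have h2 := real_inner_le_norm (T ⟨u, h⟩) (T f)
  nlinarith [sq_nonneg (‖T ⟨u, h⟩‖ - ‖T f‖), sq_nonneg (‖T ⟨u, h⟩‖)]

theorem tendsto_formResolvent (hd : Dense (T.domain : Set H)) (f : H) :
    Tendsto (fun c => T.formResolvent hT c f) atTop (𝓝 f) := by
  rw [Metric.tendsto_nhds]
  intro ε hε
  obtain ⟨g, hg, hgf⟩ := Metric.mem_closure_iff.1 (hd f) (ε / 3) (by positivity)
  filter_upwards [eventually_gt_atTop 0, eventually_gt_atTop (‖T ⟨g, hg⟩‖ ^ 2 / (ε / 3) ^ 2)]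
    with c hc hc2
  have h1 := norm_formResolvent_sub_sq_le hT hc ⟨g, hg⟩
  have h2 : ‖T.formResolvent hT c g - g‖ < ε / 3 := by
    rw [div_lt_iff₀ (by positivity)] at hc2
    have := lt_of_mul_lt_mul_left (h1.trans_lt hc2) hc.le
    exact lt_of_pow_lt_pow_left₀ 2 (by positivity) this
  have h3 := norm_formResolvent_apply_le hT hc (f - g)
  rw [dist_eq_norm] at hgf ⊢
  have : T.formResolvent hT c f - f = T.formResolvent hT c (f - g) +
      (T.formResolvent hT c g - g) - (f - g) := by rw [_root_.map_sub]; abel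
  rw [this]
  calc _ ≤ ‖T.formResolvent hT c (f - g) + (T.formResolvent hT c g - g)‖ + ‖f - g‖ :=
        norm_sub_le _ _
    _ ≤ ‖T.formResolvent hT c (f - g)‖ + ‖T.formResolvent hT c g - g‖ + ‖f - g‖ := by
        gcongr; exact norm_add_le _ _
    _ < ε := by linarith

end Resolvent

end LinearPMap

section ExpSubOne

variable {𝔸 : Type*} [NormedRing 𝔸] [NormedAlgebra ℝ 𝔸] [CompleteSpace 𝔸]

theorem NormedSpace.exp_smul_sub_one (s : ℝ) (x : 𝔸) :
    NormedSpace.exp (s • (x - 1)) = Real.exp (-s) • NormedSpace.exp (s • x) := by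
  let _ : NormedAlgebra ℚ 𝔸 := NormedAlgebra.restrictScalars ℚ ℝ 𝔸
  have h : s • (x - 1) = algebraMap ℝ 𝔸 (-s) + s • x := by
    rw [Algebra.algebraMap_eq_smul_one, smul_sub, neg_smul]; abel
  rw [h, NormedSpace.exp_add_of_commute (Algebra.commutes _ _),
    ← NormedSpace.algebraMap_exp_comm, ← Real.exp_eq_exp_ℝ]
  exact (Algebra.smul_def _ _).symm

theorem NormedSpace.norm_exp_smul_sub_one_le [NormOneClass 𝔸] {s : ℝ} (hs : 0 ≤ s) {x : 𝔸}
    (hx : ‖x‖ ≤ 1) : ‖NormedSpace.exp (s • (x - 1))‖ ≤ 1 := by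
  have h1 := NormedSpace.exp_series_hasSum_exp' (𝕂 := ℝ) (s • x)
  have h2 := NormedSpace.exp_series_hasSum_exp' (𝕂 := ℝ) s
  rw [← Real.exp_eq_exp_ℝ] at h2
  have h3 : ‖NormedSpace.exp (s • x)‖ ≤ Real.exp s := by
    rw [← h1.tsum_eq]
    refine tsum_of_norm_bounded h2 fun n => ?_
    rw [smul_pow, norm_smul, norm_smul, smul_eq_mul, norm_inv, norm_pow,
      Real.norm_of_nonneg hs, RCLike.norm_natCast]
    have : ‖x ^ n‖ ≤ 1 := (norm_pow_le x n).trans (pow_le_one₀ (norm_nonneg _) hx)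
    have : s ^ n * ‖x ^ n‖ ≤ s ^ n * 1 := by gcongr
    rw [mul_one] at this
    gcongr
  rw [NormedSpace.exp_smul_sub_one, norm_smul, Real.norm_of_nonneg (Real.exp_pos _).le]
  calc _ ≤ Real.exp (-s) * Real.exp s := by gcongr
    _ = 1 := by rw [← Real.exp_add]; simp

end ExpSubOne

theorem ContinuousLinearMap.exp_smul_sub_one_apply_mem {H : Type*} [NormedAddCommGroup H]
    [NormedSpace ℝ H] [CompleteSpace H] {C : Set H} (hC : IsClosed C) (h0 : (0 : H) ∈ C)
    (hadd : ∀ f ∈ C, ∀ g ∈ C, f + g ∈ C) (hsmul : ∀ c : ℝ, 0 ≤ c → ∀ f ∈ C, c • f ∈ C)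
    {X : H →L[ℝ] H} (hX : ∀ f ∈ C, X f ∈ C) {s : ℝ} (hs : 0 ≤ s) {f : H} (hf : f ∈ C) :
    NormedSpace.exp (s • (X - 1)) f ∈ C := by
  rw [NormedSpace.exp_smul_sub_one]
  refine hsmul _ (Real.exp_pos _).le _ ?_
  have h1 := NormedSpace.exp_series_hasSum_exp' (𝕂 := ℝ) (s • X)
  have h2 := (ContinuousLinearMap.apply ℝ H f).hasSum h1
  refine hC.mem_of_tendsto h2 (Eventually.of_forall fun F => ?_)
  have hpow : ∀ n : ℕ, (X ^ n) f ∈ C := by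
    intro n
    induction n with
    | zero => simpa using hf
    | succ n ih => rw [pow_succ']; exact hX _ ih
  refine Finset.sum_induction _ (· ∈ C) (fun a b ha hb => hadd a ha b hb) h0 fun n _ => ?_
  simp only [ContinuousLinearMap.apply_apply, smul_pow,
    smul_apply, smul_smul]
  exact hsmul _ (by positivity) _ (hpow n)

namespace LinearPMap

variable {H K : Type*} [NormedAddCommGroup H] [InnerProductSpace ℝ H] [CompleteSpace H]
  [NormedAddCommGroup K] [InnerProductSpace ℝ K] [CompleteSpace K] {T : H →ₗ.[ℝ] K}

/-- The Yosida approximation `c (c (c - L)⁻¹ - 1)` of the operator `L` of a closed form. -/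
noncomputable def yosida (T : H →ₗ.[ℝ] K) (hT : T.IsClosed) (c : ℝ) : H →L[ℝ] H :=
  c • (T.formResolvent hT c - 1)

/-- The semigroup generated by the Yosida approximation. -/
noncomputable def yosidaExp (T : H →ₗ.[ℝ] K) (hT : T.IsClosed) (c t : ℝ) : H →L[ℝ] H :=
  NormedSpace.exp (t • T.yosida hT c)

variable (hT : T.IsClosed)
include hT

theorem yosida_commute {a b : ℝ} (ha : 0 < a) (hb : 0 < b) :
    Commute (T.yosida hT a) (T.yosida hT b) :=
  ((((formResolvent_commute hT ha hb).sub_right (Commute.one_right _)).sub_left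
    (Commute.one_left _)).smul_right b).smul_left a

theorem FormGenerator.yosida_apply {u g : H} (hu : T.FormGenerator u g) {c : ℝ} (hc : 0 < c) :
    T.yosida hT c u = T.formResolvent hT c g := hu.formResolvent_apply hT hc

theorem yosidaExp_zero (c : ℝ) : T.yosidaExp hT c 0 = 1 := by
  rw [yosidaExp, zero_smul, NormedSpace.exp_zero]

theorem yosidaExp_add (c s t : ℝ) :
    T.yosidaExp hT c (s + t) = T.yosidaExp hT c s * T.yosidaExp hT c t := by
  let _ : NormedAlgebra ℚ (H →L[ℝ] H) := NormedAlgebra.restrictScalars ℚ ℝ _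
  rw [yosidaExp, add_smul, NormedSpace.exp_add_of_commute]
  · rfl
  · exact ((Commute.refl _).smul_right t).smul_left s

theorem norm_yosidaExp_le {c t : ℝ} (hc : 0 < c) (ht : 0 ≤ t) : ‖T.yosidaExp hT c t‖ ≤ 1 := by
  rcases subsingleton_or_nontrivial H with h | h
  · have : T.yosidaExp hT c t = 0 := ContinuousLinearMap.ext fun _ => Subsingleton.elim _ _
    rw [this, norm_zero]
    exact zero_le_one
  rw [yosidaExp, yosida, smul_smul]
  exact NormedSpace.norm_exp_smul_sub_one_le (by positivity) (norm_formResolvent_le hT hc)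

theorem norm_yosidaExp_apply_le {c t : ℝ} (hc : 0 < c) (ht : 0 ≤ t) (f : H) :
    ‖T.yosidaExp hT c t f‖ ≤ ‖f‖ := by
  simpa using (T.yosidaExp hT c t).le_of_opNorm_le (norm_yosidaExp_le hT hc ht) f

theorem inner_yosidaExp {c : ℝ} (hc : 0 < c) (t : ℝ) (f g : H) :
    inner ℝ (T.yosidaExp hT c t f) g = inner ℝ f (T.yosidaExp hT c t g) := by
  let _ : NormedAlgebra ℚ (H →L[ℝ] H) := NormedAlgebra.restrictScalars ℚ ℝ _
  have h1 : IsSelfAdjoint (T.formResolvent hT c) := by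
    rw [ContinuousLinearMap.isSelfAdjoint_iff_isSymmetric]
    exact fun f g => inner_formResolvent hT hc f g
  have h2 : IsSelfAdjoint (t • T.yosida hT c) :=
    (IsSelfAdjoint.all t).smul ((IsSelfAdjoint.all c).smul (h1.sub (IsSelfAdjoint.one _)))
  have h3 : IsSelfAdjoint (T.yosidaExp hT c t) := by
    rw [yosidaExp]
    exact h2.exp
  rw [ContinuousLinearMap.isSelfAdjoint_iff_isSymmetric] at h3
  exact h3 f g

theorem hasDerivAt_yosidaExp (c t : ℝ) :
    HasDerivAt (fun t => T.yosidaExp hT c t) (T.yosidaExp hT c t * T.yosida hT c) t := by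
  have := hasDerivAt_exp_smul_const (𝕂 := ℝ) (T.yosida hT c) t
  exact this

theorem norm_yosidaExp_sub_le {a b : ℝ} (ha : 0 < a) (hb : 0 < b) {t : ℝ} (ht : 0 ≤ t) (f : H) :
    ‖T.yosidaExp hT a t f - T.yosidaExp hT b t f‖ ≤ ‖T.yosida hT a f - T.yosida hT b f‖ * t := by
  let _ : NormedAlgebra ℚ (H →L[ℝ] H) := NormedAlgebra.restrictScalars ℚ ℝ _
  let φ : ℝ → H := fun s => (T.yosidaExp hT b (t - s) * T.yosidaExp hT a s) f
  have hcomm : ∀ s, Commute (T.yosidaExp hT b s) (T.yosida hT b) := fun s =>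
    ((Commute.refl (T.yosida hT b)).smul_left s).exp_left
  have hcomm' : ∀ s, Commute (T.yosidaExp hT a s) (T.yosida hT b) := fun s =>
    ((yosida_commute hT ha hb).smul_left s).exp_left
  have hφ : ∀ s, HasDerivAt φ (T.yosidaExp hT b (t - s) (T.yosidaExp hT a s
      (T.yosida hT a f - T.yosida hT b f))) s := by
    intro s
    have h1 : HasDerivAt (fun s => T.yosidaExp hT b (t - s))
        (-(T.yosidaExp hT b (t - s) * T.yosida hT b)) s := by
      have := (hasDerivAt_yosidaExp hT b (t - s)).scomp s ((hasDerivAt_id s).const_sub t)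
      rw [neg_one_smul] at this
      exact this
    have h2 := (h1.mul (hasDerivAt_yosidaExp hT a s))
    have h3 := (ContinuousLinearMap.apply ℝ H f).hasFDerivAt.comp_hasDerivAt s h2
    refine h3.congr_deriv ?_
    have e : -(T.yosidaExp hT b (t - s) * T.yosida hT b) * T.yosidaExp hT a s +
        T.yosidaExp hT b (t - s) * (T.yosidaExp hT a s * T.yosida hT a) =
        T.yosidaExp hT b (t - s) * (T.yosidaExp hT a s * (T.yosida hT a - T.yosida hT b)) := by
      rw [mul_sub (T.yosidaExp hT a s), (hcomm' s).eq]
      noncomm_ring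
    rw [e]
    rfl
  have key := norm_image_sub_le_of_norm_deriv_le_segment' (f := φ) (a := 0) (b := t)
    (f' := fun s => T.yosidaExp hT b (t - s) (T.yosidaExp hT a s
      (T.yosida hT a f - T.yosida hT b f))) (C := ‖T.yosida hT a f - T.yosida hT b f‖)
    (fun s _ => (hφ s).hasDerivWithinAt)
    (fun s hs => (norm_yosidaExp_apply_le hT hb (by linarith [hs.2]) _).trans
      (norm_yosidaExp_apply_le hT ha hs.1 _)) t ⟨ht, le_rfl⟩
  simpa [φ, yosidaExp_zero] using key

end LinearPMap

namespace LinearPMap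

variable {H K : Type*} [NormedAddCommGroup H] [InnerProductSpace ℝ H]
  [NormedAddCommGroup K] [InnerProductSpace ℝ K]

/-- `P` is a strongly continuous symmetric contraction semigroup whose generator is the operator
`-T* T` of the form `(u, v) ↦ ⟪T u, T v⟫`. -/
structure IsFormSemigroup (T : H →ₗ.[ℝ] K) (P : ℝ≥0 → H →L[ℝ] H) : Prop where
  map_zero : P 0 = ContinuousLinearMap.id ℝ _
  map_add : ∀ s t, P (s + t) = (P s).comp (P t)
  continuous : ∀ f, Continuous fun t => P t f
  contraction : ∀ t, ‖P t‖ ≤ 1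
  symmetric : ∀ t f g, inner ℝ (P t f) g = inner ℝ f (P t g)
  generator : ∀ u g : H,
    Tendsto (fun t : ℝ≥0 => (t : ℝ)⁻¹ • (P t u - u)) (𝓝[>] 0) (𝓝 g) ↔ T.FormGenerator u g

theorem tendsto_coe_nhdsGT_zero :
    Tendsto (fun t : ℝ≥0 => (t : ℝ)) (𝓝[>] 0) (𝓝[>] 0) := by
  refine tendsto_nhdsWithin_iff.2 ⟨?_, ?_⟩
  · exact (NNReal.continuous_coe.tendsto 0).mono_left nhdsWithin_le_nhds
  · filter_upwards [self_mem_nhdsWithin] with t ht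
    exact NNReal.coe_pos.2 ht

variable [CompleteSpace H] [CompleteSpace K] {T : H →ₗ.[ℝ] K} (hT : T.IsClosed)
include hT

theorem exists_formGenerator_norm_sub_lt (hd : Dense (T.domain : Set H)) (f : H) {ε : ℝ}
    (hε : 0 < ε) : ∃ u g, T.FormGenerator u g ∧ ‖f - u‖ < ε := by
  have h := (Metric.tendsto_nhds.1 (tendsto_formResolvent hT hd f)) ε hε
  obtain ⟨c, hc, hc0⟩ := (h.and (eventually_gt_atTop 0)).exists
  refine ⟨_, _, formGenerator_formResolvent hT hc0 f, ?_⟩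
  rwa [← dist_eq_norm, dist_comm]

theorem FormGenerator.tendsto_yosida (hd : Dense (T.domain : Set H)) {u g : H}
    (hu : T.FormGenerator u g) :
    Tendsto (fun n : ℕ => T.yosida hT (n + 1) u) atTop (𝓝 g) := by
  have h : Tendsto (fun n : ℕ => (n : ℝ) + 1) atTop atTop :=
    tendsto_atTop_add_const_right _ _ tendsto_natCast_atTop_atTop
  refine ((tendsto_formResolvent hT hd g).comp h).congr fun n => ?_
  exact (hu.yosida_apply hT (by positivity)).symm

theorem cauchySeq_yosidaExp (hd : Dense (T.domain : Set H)) {t : ℝ} (ht : 0 ≤ t) (f : H) :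
    CauchySeq fun n : ℕ => T.yosidaExp hT (n + 1) t f := by
  rw [Metric.cauchySeq_iff]
  intro ε hε
  obtain ⟨u, g, hu, hfu⟩ := exists_formGenerator_norm_sub_lt hT hd f
    (show 0 < ε / 3 by positivity)
  have hc := (hu.tendsto_yosida hT hd).cauchySeq
  obtain ⟨N, hN⟩ := Metric.cauchySeq_iff.1 hc (ε / (3 * (t + 1))) (by positivity)
  refine ⟨N, fun m hm n hn => ?_⟩
  have hm0 : (0 : ℝ) < m + 1 := by positivity
  have hn0 : (0 : ℝ) < n + 1 := by positivity
  have h1 := norm_yosidaExp_sub_le hT hm0 hn0 ht u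
  have h2 := hN m hm n hn
  rw [dist_eq_norm] at h2 ⊢
  have h3 : ‖T.yosida hT (m + 1) u - T.yosida hT (n + 1) u‖ * t < ε / 3 + 0 := by
    calc _ ≤ ε / (3 * (t + 1)) * t := by gcongr
      _ < ε / (3 * (t + 1)) * (t + 1) := by gcongr; linarith
      _ = ε / 3 + 0 := by field_simp; simp
  have h4 := norm_yosidaExp_apply_le hT hm0 ht (f - u)
  have h5 := norm_yosidaExp_apply_le hT hn0 ht (f - u)
  rw [_root_.map_sub] at h4 h5
  have e : T.yosidaExp hT (m + 1) t f - T.yosidaExp hT (n + 1) t f =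
    (T.yosidaExp hT (m + 1) t f - T.yosidaExp hT (m + 1) t u) +
    (T.yosidaExp hT (m + 1) t u - T.yosidaExp hT (n + 1) t u) -
    (T.yosidaExp hT (n + 1) t f - T.yosidaExp hT (n + 1) t u) := by abel
  rw [e]
  calc _ ≤ _ := norm_sub_le _ _
    _ ≤ _ := add_le_add_left (norm_add_le _ _) _
    _ < ε := by linarith

theorem norm_yosidaExp_sub_self_le {c t : ℝ} (hc : 0 < c) (ht : 0 ≤ t) (f : H) :
    ‖T.yosidaExp hT c t f - f‖ ≤ ‖T.yosida hT c f‖ * t := by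
  have key := norm_image_sub_le_of_norm_deriv_le_segment' (f := fun s => T.yosidaExp hT c s f)
    (a := 0) (b := t) (f' := fun s => T.yosidaExp hT c s (T.yosida hT c f))
    (C := ‖T.yosida hT c f‖)
    (fun s _ => ((ContinuousLinearMap.apply ℝ H f).hasFDerivAt.comp_hasDerivAt s
      (hasDerivAt_yosidaExp hT c s)).hasDerivWithinAt)
    (fun s hs => norm_yosidaExp_apply_le hT hc hs.1 _) t ⟨ht, le_rfl⟩
  simpa [yosidaExp_zero] using key

theorem tendsto_slope_yosidaExp (c : ℝ) (f : H) :
    Tendsto (fun t : ℝ≥0 => (t : ℝ)⁻¹ • (T.yosidaExp hT c t f - f)) (𝓝[>] 0)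
      (𝓝 (T.yosida hT c f)) := by
  have h := (ContinuousLinearMap.apply ℝ H f).hasFDerivAt.comp_hasDerivAt 0
      (hasDerivAt_yosidaExp hT c 0)
  rw [hasDerivAt_iff_tendsto_slope_zero] at h
  have h2 := h.comp (tendsto_coe_nhdsGT_zero.mono_right
    (nhdsWithin_mono _ fun x hx => (Set.mem_Ioi.1 hx).ne'))
  simpa [Function.comp_def, yosidaExp_zero] using h2

theorem exists_tendsto_yosidaExp (hd : Dense (T.domain : Set H)) :
    ∃ P : ℝ≥0 → H →L[ℝ] H, ∀ (t : ℝ≥0) f,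
      Tendsto (fun n : ℕ => T.yosidaExp hT (n + 1) t f) atTop (𝓝 (P t f)) := by
  have h : ∀ (t : ℝ≥0) (f : H), ∃ g, Tendsto (fun n : ℕ => T.yosidaExp hT (n + 1) t f) atTop
      (𝓝 g) := fun t f => cauchySeq_tendsto_of_complete (cauchySeq_yosidaExp hT hd t.2 f)
  choose F hF using h
  exact ⟨fun t => continuousLinearMapOfTendsto (fun n : ℕ => T.yosidaExp hT (n + 1) t)
    (f := F t) (tendsto_pi_nhds.2 fun f => hF t f), fun t f => hF t f⟩

theorem isFormSemigroup_of_tendsto_yosidaExp (hd : Dense (T.domain : Set H))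
    {P : ℝ≥0 → H →L[ℝ] H}
    (hP : ∀ (t : ℝ≥0) f, Tendsto (fun n : ℕ => T.yosidaExp hT (n + 1) t f) atTop (𝓝 (P t f))) :
    T.IsFormSemigroup P := by
  have hn0 : ∀ n : ℕ, (0 : ℝ) < n + 1 := fun n => by positivity
  have h0 : P 0 = ContinuousLinearMap.id ℝ _ := by
    refine ContinuousLinearMap.ext fun f => tendsto_nhds_unique (hP 0 f) ?_
    simp [yosidaExp_zero]
  have hcontr : ∀ t f, ‖P t f‖ ≤ ‖f‖ := fun t f =>
    le_of_tendsto (hP t f).norm (Eventually.of_forall fun n =>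
      norm_yosidaExp_apply_le hT (hn0 n) t.2 f)
  have hadd : ∀ s t, P (s + t) = (P s).comp (P t) := by
    intro s t
    refine ContinuousLinearMap.ext fun f => tendsto_nhds_unique (hP (s + t) f) ?_
    have h1 : Tendsto (fun n : ℕ => T.yosidaExp hT (n + 1) s (T.yosidaExp hT (n + 1) t f - P t f))
        atTop (𝓝 0) := by
      refine squeeze_zero_norm (fun n => norm_yosidaExp_apply_le hT (hn0 n) s.2 _) ?_
      simpa using ((hP t f).sub_const (P t f)).norm
    have h2 := h1.add (hP s (P t f))
    rw [zero_add] at h2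
    refine h2.congr fun n => ?_
    rw [_root_.map_sub, sub_add_cancel, NNReal.coe_add, yosidaExp_add]
    rfl
  have hclose : ∀ {u g}, T.FormGenerator u g → ∀ (t : ℝ≥0) (n : ℕ),
      ‖P t u - T.yosidaExp hT (n + 1) t u‖ ≤ ‖g - T.yosida hT (n + 1) u‖ * t := by
    intro u g hu t n
    refine le_of_tendsto_of_tendsto ((hP t u).sub_const _).norm
      (((hu.tendsto_yosida hT hd).sub_const _).norm.mul_const _) (Eventually.of_forall fun m => ?_)
    exact norm_yosidaExp_sub_le hT (hn0 m) (hn0 n) t.2 u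
  have hlip : ∀ {u g}, T.FormGenerator u g → ∀ (t : ℝ≥0), ‖P t u - u‖ ≤ ‖g‖ * t := by
    intro u g hu t
    refine le_of_tendsto_of_tendsto ((hP t u).sub_const _).norm
      ((hu.tendsto_yosida hT hd).norm.mul_const _) (Eventually.of_forall fun m => ?_)
    exact norm_yosidaExp_sub_self_le hT (hn0 m) t.2 u
  have hgen : ∀ {u g}, T.FormGenerator u g →
      Tendsto (fun t : ℝ≥0 => (t : ℝ)⁻¹ • (P t u - u)) (𝓝[>] 0) (𝓝 g) := by
    intro u g hu
    rw [Metric.tendsto_nhds]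
    intro ε hε
    obtain ⟨n, hn⟩ := ((Metric.tendsto_nhds.1 (hu.tendsto_yosida hT hd)) (ε / 3)
      (by positivity)).exists
    have h1 := (Metric.tendsto_nhds.1 (tendsto_slope_yosidaExp hT (n + 1) u)) (ε / 3)
      (by positivity)
    filter_upwards [h1, self_mem_nhdsWithin] with t ht ht0
    have ht0 : (0 : ℝ) < t := NNReal.coe_pos.2 ht0
    have h2 : ‖(t : ℝ)⁻¹ • (P t u - T.yosidaExp hT (n + 1) t u)‖ < ε / 3 := by
      rw [norm_smul, norm_inv, Real.norm_of_nonneg ht0.le, inv_mul_lt_iff₀ ht0, mul_comm]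
      refine (hclose hu t n).trans_lt ?_
      rw [dist_comm, dist_eq_norm] at hn
      gcongr
    rw [dist_eq_norm] at hn ht ⊢
    have e : (t : ℝ)⁻¹ • (P t u - u) - g = (t : ℝ)⁻¹ • (P t u - T.yosidaExp hT (n + 1) t u) +
      ((t : ℝ)⁻¹ • (T.yosidaExp hT (n + 1) t u - u) - T.yosida hT (n + 1) u) +
      (T.yosida hT (n + 1) u - g) := by module
    rw [e]
    calc _ ≤ _ := norm_add₃_le
      _ < ε := by linarith
  refine ⟨h0, hadd, ?_, ?_, ?_, ?_⟩
  · intro f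
    have hzero : ∀ ε > 0, ∃ δ > 0, ∀ t : ℝ≥0, (t : ℝ) < δ → ‖P t f - f‖ < ε := by
      intro ε hε
      obtain ⟨u, g, hu, hfu⟩ := exists_formGenerator_norm_sub_lt hT hd f
        (show 0 < ε / 3 by positivity)
      refine ⟨ε / (3 * (‖g‖ + 1)), by positivity, fun t ht => ?_⟩
      have h1 := hlip hu t
      have h2 : ‖g‖ * t < ε / 3 := by
        calc _ ≤ (‖g‖ + 1) * (t : ℝ) := by gcongr; linarith
          _ < (‖g‖ + 1) * (ε / (3 * (‖g‖ + 1))) := by gcongr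
          _ = ε / 3 := by field_simp
      have h3 := hcontr t (f - u)
      have e : P t f - f = P t (f - u) + (P t u - u) - (f - u) := by
        rw [_root_.map_sub]; abel
      rw [e]
      calc _ ≤ _ := norm_sub_le _ _
        _ ≤ _ := add_le_add_left (norm_add_le _ _) _
        _ < ε := by linarith
    have hmono : ∀ s t : ℝ≥0, s ≤ t → ‖P t f - P s f‖ ≤ ‖P (t - s) f - f‖ := by
      intro s t hst
      have : P t f = P s (P (t - s) f) := by
        conv_lhs => rw [← add_tsub_cancel_of_le hst, hadd]
        rfl
      rw [this, ← _root_.map_sub]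
      exact hcontr _ _
    rw [Metric.continuous_iff]
    intro s ε hε
    obtain ⟨δ, hδ, h⟩ := hzero ε hε
    refine ⟨δ, hδ, fun t ht => ?_⟩
    rw [NNReal.dist_eq] at ht
    rw [dist_eq_norm]
    rcases le_total s t with hst | hst
    · refine (hmono s t hst).trans_lt (h _ ?_)
      rw [NNReal.coe_sub hst]
      exact (le_abs_self _).trans_lt ht
    · rw [norm_sub_rev]
      refine (hmono t s hst).trans_lt (h _ ?_)
      rw [NNReal.coe_sub hst]
      rw [abs_sub_comm] at ht
      exact (le_abs_self _).trans_lt ht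
  · exact fun t => ContinuousLinearMap.opNorm_le_bound _ zero_le_one fun f => by
      simpa using hcontr t f
  · intro t f g
    refine tendsto_nhds_unique ((hP t f).inner tendsto_const_nhds)
      ((tendsto_const_nhds.inner (hP t g)).congr fun n => ?_)
    exact (inner_yosidaExp hT (hn0 n) t f g).symm
  · refine fun u g => ⟨fun h => ?_, hgen⟩
    set v := T.formResolvent hT 1 (u - g) with hv
    have hvg := formGenerator_formResolvent hT one_pos (u - g)
    rw [← hv, one_smul] at hvg
    have h1 := (hgen hvg).sub h
    have h2 : inner ℝ (v - (u - g) - g) (v - u) ≤ 0 := by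
      refine le_of_tendsto (h1.inner (tendsto_const_nhds (x := v - u)))
        (eventually_nhdsWithin_of_forall fun t ht => ?_)
      have e : (t : ℝ)⁻¹ • (P t v - v) - (t : ℝ)⁻¹ • (P t u - u) =
          (t : ℝ)⁻¹ • (P t (v - u) - (v - u)) := by rw [_root_.map_sub]; module
      rw [e, inner_smul_left, conj_trivial, inner_sub_left, real_inner_self_eq_norm_sq]
      have h3 := real_inner_le_norm (P t (v - u)) (v - u)
      have h4 := mul_le_mul_of_nonneg_right (hcontr t (v - u)) (norm_nonneg (v - u))
      refine mul_nonpos_of_nonneg_of_nonpos (by positivity) ?_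
      nlinarith
    have e : v - (u - g) - g = v - u := by abel
    rw [e, real_inner_self_eq_norm_sq] at h2
    have h5 : ‖v - u‖ = 0 := pow_eq_zero_iff two_ne_zero |>.1 (le_antisymm h2 (sq_nonneg _))
    have h6 : v = u := sub_eq_zero.1 (norm_eq_zero.1 h5)
    rw [h6] at hvg
    simpa using hvg

end LinearPMap

namespace LinearPMap.IsFormSemigroup

variable {H K : Type*} [NormedAddCommGroup H] [InnerProductSpace ℝ H]
  [NormedAddCommGroup K] [InnerProductSpace ℝ K] {T : H →ₗ.[ℝ] K} {P : ℝ≥0 → H →L[ℝ] H}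

theorem norm_apply_le (hP : T.IsFormSemigroup P) (t : ℝ≥0) (f : H) : ‖P t f‖ ≤ ‖f‖ := by
  simpa using (P t).le_of_opNorm_le (hP.contraction t) f

theorem formGenerator_apply (hP : T.IsFormSemigroup P) {u g : H} (hu : T.FormGenerator u g)
    (t : ℝ≥0) : T.FormGenerator (P t u) (P t g) := by
  rw [← hP.generator] at hu ⊢
  refine (((P t).continuous.tendsto g).comp hu).congr fun s => ?_
  have h : ∀ f, P t (P s f) = P s (P t f) := fun f => by
    rw [← ContinuousLinearMap.comp_apply, ← hP.map_add, add_comm, hP.map_add]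
    rfl
  simp only [Function.comp, _root_.map_smul, _root_.map_sub, h]

theorem hasDerivWithinAt (hP : T.IsFormSemigroup P) {u g : H} (hu : T.FormGenerator u g)
    {s : ℝ} (hs : 0 ≤ s) :
    HasDerivWithinAt (fun s : ℝ => P s.toNNReal u) (P s.toNNReal g) (Set.Ici s) s := by
  rw [← hasDerivWithinAt_Ioi_iff_Ici, hasDerivWithinAt_iff_tendsto_slope' (by simp)]
  have h1 : Tendsto (fun y : ℝ => (y - s).toNNReal) (𝓝[>] s) (𝓝[>] 0) := by
    refine tendsto_nhdsWithin_iff.2 ⟨?_, ?_⟩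
    · have : Continuous fun y : ℝ => (y - s).toNNReal := by fun_prop
      simpa using (this.tendsto s).mono_left nhdsWithin_le_nhds
    · filter_upwards [self_mem_nhdsWithin] with y hy
      exact Real.toNNReal_pos.2 (sub_pos.2 hy)
  refine (((hP.generator _ _).2 (hP.formGenerator_apply hu s.toNNReal)).comp h1).congr' ?_
  filter_upwards [self_mem_nhdsWithin] with y hy
  have hy' : s < y := hy
  simp only [Function.comp, slope_def_module]
  rw [Real.coe_toNNReal _ (sub_pos.2 hy').le, ← ContinuousLinearMap.comp_apply, ← hP.map_add,
    ← Real.toNNReal_add (sub_pos.2 hy').le hs, sub_add_cancel]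

theorem continuous_toNNReal (hP : T.IsFormSemigroup P) (f : H) :
    Continuous fun s : ℝ => P s.toNNReal f :=
  (hP.continuous f).comp continuous_real_toNNReal

variable [CompleteSpace H] [CompleteSpace K]

theorem unique (hT : T.IsClosed) (hd : Dense (T.domain : Set H)) {Q : ℝ≥0 → H →L[ℝ] H}
    (hP : T.IsFormSemigroup P) (hQ : T.IsFormSemigroup Q) : P = Q := by
  have key : ∀ u g, T.FormGenerator u g → ∀ t : ℝ≥0, P t u = Q t u := by
    intro u g hu t
    have h1 : ∀ x ∈ Set.Ico (0 : ℝ) t, HasDerivWithinAt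
        (fun s : ℝ => ‖P s.toNNReal u - Q s.toNNReal u‖ ^ 2)
        (2 * inner ℝ (P x.toNNReal u - Q x.toNNReal u) (P x.toNNReal g - Q x.toNNReal g))
        (Set.Ici x) x := fun x hx =>
      ((hP.hasDerivWithinAt hu hx.1).sub (hQ.hasDerivWithinAt hu hx.1)).norm_sq
    have h2 := image_le_of_deriv_right_le_deriv_boundary (B := fun _ => 0) (B' := fun _ => 0)
      (((hP.continuous_toNNReal u).sub (hQ.continuous_toNNReal u)).norm.pow 2).continuousOn
      h1 (by simp [hP.map_zero, hQ.map_zero]) continuousOn_const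
      (fun x _ => hasDerivWithinAt_const _ _ _) (fun x _ => by
        have := ((hP.formGenerator_apply hu x.toNNReal).sub
          (hQ.formGenerator_apply hu x.toNNReal)).inner_self_nonpos
        rw [real_inner_comm] at this
        linarith) (Set.right_mem_Icc.2 t.coe_nonneg)
    simp only [Pi.pow_apply, Pi.sub_apply, Real.toNNReal_coe] at h2
    have h3 : ‖P t u - Q t u‖ = 0 := pow_eq_zero_iff two_ne_zero |>.1 (le_antisymm h2 (sq_nonneg _))
    exact sub_eq_zero.1 (norm_eq_zero.1 h3)
  funext t
  refine ContinuousLinearMap.ext fun f => ?_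
  have hlim := tendsto_formResolvent hT hd f
  refine tendsto_nhds_unique (((P t).continuous.tendsto f).comp hlim)
    ((((Q t).continuous.tendsto f).comp hlim).congr' ?_)
  filter_upwards [eventually_gt_atTop 0] with c hc
  exact (key _ _ (formGenerator_formResolvent hT hc f) t).symm

theorem norm_sq_le (hT : T.IsClosed) (hd : Dense (T.domain : Set H)) (hP : T.IsFormSemigroup P)
    {N : H → ℝ} (hN : Continuous N) (hN0 : ∀ f, 0 ≤ N f) (hNP : ∀ t f, N (P t f) ≤ N f)
    {r b : ℝ} (hr : 0 < r) (hb : 0 ≤ b)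
    (h : ∀ u : T.domain, ‖(u : H)‖ ^ 2 ≤ r * ‖T u‖ ^ 2 + b * N u ^ 2) (t : ℝ≥0) (f : H) :
    ‖P t f‖ ^ 2 ≤ Real.exp (-(2 / r) * t) * ‖f‖ ^ 2 + b * N f ^ 2 := by
  have key : ∀ u g, T.FormGenerator u g →
      ‖P t u‖ ^ 2 ≤ Real.exp (-(2 / r) * t) * ‖u‖ ^ 2 + b * N u ^ 2 := by
    intro u g hu
    have hexp : ∀ x : ℝ, HasDerivAt (fun s : ℝ => Real.exp (2 / r * s))
        (Real.exp (2 / r * x) * (2 / r)) x := fun x => by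
      simpa using ((hasDerivAt_id x).const_mul (2 / r)).exp
    have h1 : ∀ x ∈ Set.Ico (0 : ℝ) t, HasDerivWithinAt
        (fun s : ℝ => Real.exp (2 / r * s) * (‖P s.toNNReal u‖ ^ 2 - b * N u ^ 2))
        (Real.exp (2 / r * x) * (2 / r) * (‖P x.toNNReal u‖ ^ 2 - b * N u ^ 2) +
          Real.exp (2 / r * x) * (2 * inner ℝ (P x.toNNReal u) (P x.toNNReal g)))
        (Set.Ici x) x := fun x hx =>
      (hexp x).hasDerivWithinAt.mul ((hP.hasDerivWithinAt hu hx.1).norm_sq.sub_const _)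
    have h2 := image_le_of_deriv_right_le_deriv_boundary (B := fun _ => ‖u‖ ^ 2 - b * N u ^ 2)
      (B' := fun _ => 0) (ContinuousOn.mul (by fun_prop)
        (((hP.continuous_toNNReal u).norm.pow 2).sub continuous_const).continuousOn)
      h1 (by simp [hP.map_zero]) continuousOn_const
      (fun x _ => hasDerivWithinAt_const _ _ _) (fun x _ => by
        have hg := hP.formGenerator_apply hu x.toNNReal
        have h3 := hg.inner_self_eq
        have h4 := h ⟨_, hg.1⟩
        have h5 : b * N (P x.toNNReal u) ^ 2 ≤ b * N u ^ 2 := by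
          gcongr
          · exact hN0 _
          · exact hNP _ _
        rw [real_inner_comm, h3]
        have h6 : 2 / r * (‖P x.toNNReal u‖ ^ 2 - b * N u ^ 2) ≤
            2 * ‖T ⟨_, hg.1⟩‖ ^ 2 := by
          calc _ ≤ 2 / r * (r * ‖T ⟨_, hg.1⟩‖ ^ 2) := by
                gcongr
                simp only at h4
                linarith
            _ = _ := by field_simp
        rw [mul_assoc, ← mul_add]
        exact mul_nonpos_of_nonneg_of_nonpos (Real.exp_pos _).le (by linarith))
      (Set.right_mem_Icc.2 t.coe_nonneg)
    simp only [Pi.mul_apply, Pi.pow_apply, Pi.sub_apply, Real.toNNReal_coe] at h2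
    have h3 : ‖P t u‖ ^ 2 - b * N u ^ 2 ≤
        Real.exp (-(2 / r) * t) * (‖u‖ ^ 2 - b * N u ^ 2) := by
      rw [neg_mul, Real.exp_neg, ← div_eq_inv_mul, le_div_iff₀ (Real.exp_pos _), mul_comm]
      exact h2
    have h4 : 0 ≤ Real.exp (-(2 / r) * t) * (b * N u ^ 2) := by positivity
    linarith
  have hlim := tendsto_formResolvent hT hd f
  refine le_of_tendsto_of_tendsto ((((P t).continuous.tendsto f).comp hlim).norm.pow 2)
    ((hlim.norm.pow 2).const_mul _ |>.add ((((hN.tendsto f).comp hlim).pow 2).const_mul b)) ?_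
  filter_upwards [eventually_gt_atTop 0] with c hc
  exact key _ _ (formGenerator_formResolvent hT hc f)

end LinearPMap.IsFormSemigroup

namespace LinearPMap.IsFormSemigroup

variable {H K : Type*} [NormedAddCommGroup H] [InnerProductSpace ℝ H]
  [NormedAddCommGroup K] [InnerProductSpace ℝ K] {T : H →ₗ.[ℝ] K} {P : ℝ≥0 → H →L[ℝ] H}

theorem apply_eq_self (hP : T.IsFormSemigroup P) {u : H} (hu : T.FormGenerator u 0) (t : ℝ≥0) :
    P t u = u := by
  have h := constant_of_has_deriv_right_zero (a := 0) (b := t)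
    (hP.continuous_toNNReal u).continuousOn (fun x hx => by
      simpa using hP.hasDerivWithinAt hu hx.1) t (Set.right_mem_Icc.2 t.coe_nonneg)
  simpa [hP.map_zero] using h

end LinearPMap.IsFormSemigroup

noncomputable section

namespace StableLike

variable {d : ℕ} {α : ℝ} {V : EuclideanSpace ℝ (Fin d) → ℝ}

theorem lintegral_ne_top_of_gibbs [h : IsProbabilityMeasure (gibbs V)] :
    ∫⁻ x, ENNReal.ofReal (Real.exp (-V x)) ≠ ∞ := by
  intro h1
  have h2 := h.measure_univ
  rw [gibbs, h1] at h2
  simp at h2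

theorem absolutelyContinuous_gibbs (hV : Measurable V) [h : IsProbabilityMeasure (gibbs V)] :
    volume ≪ gibbs V := by
  have h0 : (∫⁻ x, ENNReal.ofReal (Real.exp (-V x)))⁻¹ ≠ 0 :=
    ENNReal.inv_ne_zero.2 lintegral_ne_top_of_gibbs
  refine (withDensity_absolutelyContinuous' (f := fun x => ENNReal.ofReal (Real.exp (-V x)))
    (by fun_prop) (ae_of_all _ fun x => ?_)).trans
    (Measure.absolutelyContinuous_smul h0)
  exact (ENNReal.ofReal_pos.2 (Real.exp_pos _)).ne'

/-- The difference quotient `(f(x) - f(y)) / |x - y|^{(d + α) / 2}` at `(x, y)`. -/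
def diffQuot (α : ℝ) (f : EuclideanSpace ℝ (Fin d) → ℝ)
    (p : EuclideanSpace ℝ (Fin d) × EuclideanSpace ℝ (Fin d)) : ℝ :=
  (f p.1 - f p.2) / ‖p.1 - p.2‖ ^ (((d : ℝ) + α) / 2)

theorem kernel_eq_diffQuot_mul (f g : EuclideanSpace ℝ (Fin d) → ℝ)
    (p : EuclideanSpace ℝ (Fin d) × EuclideanSpace ℝ (Fin d)) :
    kernel α f g p = diffQuot α f p * diffQuot α g p := by
  rw [kernel, diffQuot, diffQuot, div_mul_div_comm, ← sq, ← Real.rpow_mul_natCast (norm_nonneg _)]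
  norm_num

theorem kernel_self_nonneg (f : EuclideanSpace ℝ (Fin d) → ℝ)
    (p : EuclideanSpace ℝ (Fin d) × EuclideanSpace ℝ (Fin d)) : 0 ≤ kernel α f f p := by
  rw [kernel_eq_diffQuot_mul]
  exact mul_self_nonneg _

theorem measurable_diffQuot {f : EuclideanSpace ℝ (Fin d) → ℝ} (hf : Measurable f) :
    Measurable (diffQuot α f) := by
  unfold diffQuot
  fun_prop

theorem ae_comp_fst {q : EuclideanSpace ℝ (Fin d) → Prop} (h : ∀ᵐ x ∂gibbs V, q x) :
    ∀ᵐ p ∂(gibbs V).prod (volume : Measure (EuclideanSpace ℝ (Fin d))), q p.1 :=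
  Measure.quasiMeasurePreserving_fst.ae h

variable [IsProbabilityMeasure (gibbs V)]

theorem ae_comp_snd (hV : Measurable V) {q : EuclideanSpace ℝ (Fin d) → Prop}
    (h : ∀ᵐ x ∂gibbs V, q x) :
    ∀ᵐ p ∂(gibbs V).prod (volume : Measure (EuclideanSpace ℝ (Fin d))), q p.2 :=
  Measure.quasiMeasurePreserving_snd.ae ((absolutelyContinuous_gibbs hV).ae_le h)

theorem diffQuot_congr (hV : Measurable V) {f g : EuclideanSpace ℝ (Fin d) → ℝ}
    (h : f =ᵐ[gibbs V] g) : diffQuot α f =ᵐ[(gibbs V).prod volume] diffQuot α g := by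
  filter_upwards [ae_comp_fst h, ae_comp_snd hV h] with p h1 h2
  rw [diffQuot, diffQuot, h1, h2]

theorem diffQuot_add (hV : Measurable V) (f g : Lp ℝ 2 (gibbs V)) :
    diffQuot α (f + g : Lp ℝ 2 (gibbs V)) =ᵐ[(gibbs V).prod volume]
      diffQuot α f + diffQuot α g := by
  filter_upwards [diffQuot_congr hV (Lp.coeFn_add f g)] with p hp
  rw [hp]
  simp only [diffQuot, Pi.add_apply]
  ring

theorem diffQuot_smul (hV : Measurable V) (c : ℝ) (f : Lp ℝ 2 (gibbs V)) :
    diffQuot α (c • f : Lp ℝ 2 (gibbs V)) =ᵐ[(gibbs V).prod volume] c • diffQuot α f := by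
  filter_upwards [diffQuot_congr hV (Lp.coeFn_smul c f)] with p hp
  rw [hp]
  simp only [diffQuot, Pi.smul_apply, smul_eq_mul]
  ring

/-- The difference quotient as a densely defined operator `L²(μ_V) → L²(μ_V(dx) dy)`. -/
def diffOp (α : ℝ) (hV : Measurable V) :
    Lp ℝ 2 (gibbs V) →ₗ.[ℝ] Lp ℝ 2 ((gibbs V).prod (volume : Measure (EuclideanSpace ℝ (Fin d))))
    where
  domain :=
    { carrier := {f | MemLp (diffQuot α f) 2 ((gibbs V).prod volume)}
      add_mem' := fun {f g} hf hg => (hf.add hg).ae_eq (diffQuot_add hV f g).symm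
      zero_mem' := by
        refine MemLp.zero.ae_eq (g := diffQuot α (0 : Lp ℝ 2 (gibbs V))) ?_
        filter_upwards [diffQuot_congr (α := α) hV (Lp.coeFn_zero ℝ 2 (gibbs V))] with p hp
        rw [hp]
        simp [diffQuot]
      smul_mem' := fun c f hf => (MemLp.const_smul hf c).ae_eq (diffQuot_smul hV c f).symm }
  toFun :=
    { toFun := fun f => MemLp.toLp _ f.2
      map_add' := fun f g => (MemLp.toLp_congr _ (f.2.add g.2) (diffQuot_add hV f.1 g.1)).trans
        (MemLp.toLp_add f.2 g.2)
      map_smul' := fun c f => (MemLp.toLp_congr _ (f.2.const_smul c)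
        (diffQuot_smul hV c f.1)).trans (MemLp.toLp_const_smul c f.2) }

theorem mem_diffOp_domain (hV : Measurable V) {f : Lp ℝ 2 (gibbs V)} :
    f ∈ (diffOp α hV).domain ↔ MemLp (diffQuot α f) 2 ((gibbs V).prod volume) := Iff.rfl

theorem coeFn_diffOp (hV : Measurable V) (f : (diffOp α hV).domain) :
    diffOp α hV f =ᵐ[(gibbs V).prod volume] diffQuot α (f : Lp ℝ 2 (gibbs V)) :=
  MemLp.coeFn_toLp f.2

theorem mem_diffOp_domain_iff (hV : Measurable V) {f : Lp ℝ 2 (gibbs V)} :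
    f ∈ (diffOp α hV).domain ↔ f ∈ formDomain α V := by
  rw [mem_diffOp_domain, memLp_two_iff_integrable_sq
    (measurable_diffQuot (Lp.stronglyMeasurable f).measurable).aestronglyMeasurable]
  simp only [formDomain, Set.mem_ofPred_eq, sq, ← kernel_eq_diffQuot_mul]

theorem inner_diffOp (hV : Measurable V) (f g : (diffOp α hV).domain) :
    inner ℝ (diffOp α hV f) (diffOp α hV g) = form α V f g := by
  rw [L2.inner_def, form]
  refine integral_congr_ae ?_
  filter_upwards [coeFn_diffOp hV f, coeFn_diffOp hV g] with p h1 h2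
  rw [h1, h2, kernel_eq_diffQuot_mul, RCLike.inner_apply, conj_trivial, mul_comm]

theorem formGenerator_diffOp_iff (hV : Measurable V) (u g : Lp ℝ 2 (gibbs V)) :
    (diffOp α hV).FormGenerator u g ↔
      u ∈ formDomain α V ∧ ∀ v ∈ formDomain α V, form α V u v = -inner ℝ g v := by
  constructor
  · rintro ⟨h, hv⟩
    refine ⟨(mem_diffOp_domain_iff hV).1 h, fun v hvd => ?_⟩
    rw [← hv ⟨v, (mem_diffOp_domain_iff hV).2 hvd⟩, inner_diffOp]
  · rintro ⟨h, hv⟩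
    refine ⟨(mem_diffOp_domain_iff hV).2 h, fun v => ?_⟩
    rw [← hv v ((mem_diffOp_domain_iff hV).1 v.2), inner_diffOp]

theorem isClosed_diffOp (hV : Measurable V) : (diffOp α hV).IsClosed := by
  refine IsSeqClosed.isClosed fun w q hw hq => ?_
  have hw' : ∀ n, ∃ y : (diffOp α hV).domain, (y : Lp ℝ 2 (gibbs V)) = (w n).1 ∧
      diffOp α hV y = (w n).2 := fun n => (LinearPMap.mem_graph_iff _).1 (hw n)
  choose y hy1 hy2 using hw'
  have h1 : Tendsto (fun n => (w n).1) atTop (𝓝 q.1) := (continuous_fst.tendsto q).comp hq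
  have h2 : Tendsto (fun n => (w n).2) atTop (𝓝 q.2) := (continuous_snd.tendsto q).comp hq
  obtain ⟨φ, hφ, hφl⟩ := (tendstoInMeasure_of_tendsto_Lp h1).exists_seq_tendsto_ae
  obtain ⟨ψ, hψ, hψl⟩ := (tendstoInMeasure_of_tendsto_Lp
    (h2.comp hφ.tendsto_atTop)).exists_seq_tendsto_ae
  have hae : ∀ᵐ p ∂(gibbs V).prod (volume : Measure (EuclideanSpace ℝ (Fin d))),
      ∀ n, (w n).2 p = diffQuot α (w n).1 p := by
    rw [ae_all_iff]
    intro n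
    rw [← hy1, ← hy2]
    exact coeFn_diffOp hV (y n)
  have hq2 : q.2 =ᵐ[(gibbs V).prod volume] diffQuot α q.1 := by
    filter_upwards [hae, hψl, ae_comp_fst hφl, ae_comp_snd hV hφl] with p e1 e2 e3 e4
    refine tendsto_nhds_unique e2 ?_
    simp only [Function.comp, e1]
    exact ((e3.comp hψ.tendsto_atTop).sub (e4.comp hψ.tendsto_atTop)).div_const _
  have hmem : q.1 ∈ (diffOp α hV).domain := (Lp.memLp q.2).ae_eq hq2
  refine (LinearPMap.mem_graph_iff _).2 ⟨⟨q.1, hmem⟩, rfl, ?_⟩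
  exact Lp.ext ((coeFn_diffOp hV ⟨q.1, hmem⟩).trans hq2.symm)

theorem formGenerator_const_zero (hV : Measurable V) {f : Lp ℝ 2 (gibbs V)} {c : ℝ}
    (hf : ∀ᵐ x ∂gibbs V, f x = c) : (diffOp α hV).FormGenerator f 0 := by
  have h0 : diffQuot α f =ᵐ[(gibbs V).prod volume] 0 := by
    refine (diffQuot_congr hV (g := fun _ => c) hf).trans (Eventually.of_forall fun p => ?_)
    simp [diffQuot]
  have hmem : f ∈ (diffOp α hV).domain :=
    (MemLp.zero (ε := ℝ)).ae_eq h0.symm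
  refine ⟨hmem, fun v => ?_⟩
  have : diffOp α hV ⟨f, hmem⟩ = 0 :=
    Lp.ext (((coeFn_diffOp hV ⟨f, hmem⟩).trans h0).trans (Lp.coeFn_zero _ _ _).symm)
  rw [this]
  simp

theorem formResolvent_nonneg (hV : Measurable V) {c : ℝ} (hc : 0 < c) {f : Lp ℝ 2 (gibbs V)}
    (hf : 0 ≤ f) : 0 ≤ (diffOp α hV).formResolvent (isClosed_diffOp hV) c f := by
  obtain ⟨hu, hv⟩ := LinearPMap.formGenerator_formResolvent (isClosed_diffOp (α := α) hV) hc f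
  set u := (diffOp α hV).formResolvent (isClosed_diffOp hV) c f
  have hneg : diffQuot α (Lp.negPart u) =ᵐ[(gibbs V).prod volume]
      diffQuot α fun x => -min (u x) 0 := diffQuot_congr hV (Lp.coeFn_negPart u)
  have hle : ∀ a b : ℝ, |-min a 0 - -min b 0| ≤ |a - b| := by
    intro a b
    have := abs_min_sub_min_le_max a 0 b 0
    rw [sub_self, abs_zero, max_eq_left (abs_nonneg _)] at this
    rwa [neg_sub_neg, abs_sub_comm]
  have hmem : Lp.negPart u ∈ (diffOp α hV).domain := by
    refine MemLp.mono hu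
      (measurable_diffQuot (Lp.stronglyMeasurable _).measurable).aestronglyMeasurable ?_
    filter_upwards [hneg] with p hp
    rw [hp, diffQuot, diffQuot, norm_div, norm_div]
    gcongr
    exact hle _ _
  have h1 := hv ⟨_, hmem⟩
  have h2 : inner ℝ (diffOp α hV ⟨u, hu⟩) (diffOp α hV ⟨_, hmem⟩) ≤ 0 := by
    rw [L2.inner_def]
    refine integral_nonpos_of_ae ?_
    filter_upwards [coeFn_diffOp hV ⟨u, hu⟩, coeFn_diffOp hV ⟨_, hmem⟩, hneg] with p e1 e2 e3
    rw [e1, e2, e3, RCLike.inner_apply, conj_trivial, diffQuot, diffQuot, div_mul_div_comm]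
    refine div_nonpos_of_nonpos_of_nonneg ?_ (by positivity)
    rcases le_total (u p.1) (u p.2) with h | h
    · exact mul_nonpos_of_nonneg_of_nonpos
        (by have := min_le_min_right 0 h; linarith) (by linarith)
    · exact mul_nonpos_of_nonpos_of_nonneg
        (by have := min_le_min_right 0 h; linarith) (by linarith)
  have h3 : inner ℝ u (Lp.negPart u) = -‖Lp.negPart u‖ ^ 2 := by
    rw [← real_inner_self_eq_norm_sq, ← inner_neg_left, L2.inner_def, L2.inner_def]
    refine integral_congr_ae ?_
    filter_upwards [Lp.coeFn_negPart u, Lp.coeFn_neg (Lp.negPart u)] with x e1 e2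
    simp only [e2, Pi.neg_apply, e1, RCLike.inner_apply, conj_trivial]
    rcases le_total (u x) 0 with h | h
    · simp [h]
    · simp [h]
  have h4 : 0 ≤ inner ℝ f (Lp.negPart u) := by
    rw [L2.inner_def]
    refine integral_nonneg_of_ae ?_
    filter_upwards [(Lp.coeFn_nonneg f).2 hf, Lp.coeFn_negPart u] with x e1 e2
    rw [e2, RCLike.inner_apply, conj_trivial]
    exact mul_nonneg (by simp) e1
  rw [h1, inner_smul_left, conj_trivial, inner_sub_left, h3] at h2
  have h5 : ‖Lp.negPart u‖ ^ 2 ≤ 0 := by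
    by_contra! h6
    nlinarith [mul_pos hc h6, mul_nonneg hc.le h4]
  have h6 : Lp.negPart u = 0 :=
    norm_eq_zero.1 (pow_eq_zero_iff two_ne_zero |>.1 (le_antisymm h5 (sq_nonneg _)))
  rw [← Lp.coeFn_nonneg]
  have h7 := Lp.coeFn_negPart u
  rw [h6] at h7
  filter_upwards [h7, Lp.coeFn_zero ℝ 2 (gibbs V)] with x e1 e2
  rw [e2] at e1
  simpa using e1

theorem exists_isAssociatedSemigroup (hV : Measurable V)
    (hd : Dense ((diffOp α hV).domain : Set (Lp ℝ 2 (gibbs V)))) :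
    ∃ P, IsAssociatedSemigroup α V P := by
  obtain ⟨P, hlim⟩ := LinearPMap.exists_tendsto_yosidaExp (isClosed_diffOp hV) hd
  have hP := LinearPMap.isFormSemigroup_of_tendsto_yosidaExp (isClosed_diffOp hV) hd hlim
  refine ⟨P, hP.map_zero, hP.map_add, hP.continuous, hP.contraction, hP.symmetric, ?_, ?_, ?_⟩
  · intro t f hf
    have hf' : 0 ≤ f := (Lp.coeFn_nonneg f).1 hf
    refine (Lp.coeFn_nonneg _).2 (ge_of_tendsto (hlim t f) (Eventually.of_forall fun n => ?_))
    have hn : (0 : ℝ) < n + 1 := by positivity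
    rw [LinearPMap.yosidaExp, LinearPMap.yosida, smul_smul]
    exact ContinuousLinearMap.exp_smul_sub_one_apply_mem (C := Set.Ici 0) isClosed_Ici
      Set.self_mem_Ici (fun f hf g hg => add_nonneg (Set.mem_Ici.1 hf) hg)
      (fun c hc f hf => (Lp.coeFn_nonneg _).1 <| by
        filter_upwards [(Lp.coeFn_nonneg f).2 (Set.mem_Ici.1 hf), Lp.coeFn_smul c f] with x h1 h2
        rw [h2]
        exact mul_nonneg hc h1)
      (fun f hf => formResolvent_nonneg hV hn hf) (mul_nonneg t.2 hn.le) (Set.mem_Ici.2 hf')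
  · intro t f hf
    rw [hP.apply_eq_self (formGenerator_const_zero hV hf)]
    exact hf
  · intro u g
    rw [hP.generator, formGenerator_diffOp_iff]

theorem IsAssociatedSemigroup.isFormSemigroup (hV : Measurable V)
    {P : ℝ≥0 → Lp ℝ 2 (gibbs V) →L[ℝ] Lp ℝ 2 (gibbs V)} (hP : IsAssociatedSemigroup α V P) :
    (diffOp α hV).IsFormSemigroup P :=
  ⟨hP.map_zero, hP.map_add, hP.continuous, hP.contraction, hP.symmetric, fun u g => by
    rw [hP.generator, formGenerator_diffOp_iff]⟩

theorem existsUnique_isAssociatedSemigroup (hV : Measurable V)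
    (hd : Dense ((diffOp α hV).domain : Set (Lp ℝ 2 (gibbs V)))) :
    ∃! P, IsAssociatedSemigroup α V P := by
  obtain ⟨P, hP⟩ := exists_isAssociatedSemigroup hV hd
  exact ⟨P, hP, fun Q hQ =>
    (hQ.isFormSemigroup hV).unique (isClosed_diffOp hV) hd (hP.isFormSemigroup hV)⟩

end StableLike

end

noncomputable section

namespace StableLike

variable {d : ℕ} {α : ℝ} {V : EuclideanSpace ℝ (Fin d) → ℝ}

theorem integrable_min_one_sq_div (hd : 0 < d) (hα₀ : 0 < α) (hα₂ : α < 2) :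
    Integrable fun z : EuclideanSpace ℝ (Fin d) => min 1 (‖z‖ ^ 2) / ‖z‖ ^ ((d : ℝ) + α) := by
  have hfr : Module.finrank ℝ (EuclideanSpace ℝ (Fin d)) = d := finrank_euclideanSpace_fin
  have hmeas : Measurable fun z : EuclideanSpace ℝ (Fin d) =>
      min 1 (‖z‖ ^ 2) / ‖z‖ ^ ((d : ℝ) + α) := by fun_prop
  have h1 : IntegrableOn (fun z : EuclideanSpace ℝ (Fin d) =>
      min 1 (‖z‖ ^ 2) / ‖z‖ ^ ((d : ℝ) + α)) (Metric.ball 0 1) := by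
    refine integrableOn_ball_of_norm_le_rpow (C := 1) (α := d + α - 2) (by rw [hfr]; exact hd)
      (by rw [hfr]; linarith) (ae_of_all _ fun z => ?_) hmeas.aestronglyMeasurable
    rw [Real.norm_of_nonneg (by positivity), one_mul]
    rcases eq_or_ne z 0 with rfl | hz
    · simp only [norm_zero]
      rw [Real.zero_rpow (by positivity), div_zero]
      exact Real.rpow_nonneg le_rfl _
    · have hz' : 0 < ‖z‖ := norm_pos_iff.2 hz
      calc _ ≤ ‖z‖ ^ 2 / ‖z‖ ^ ((d : ℝ) + α) := by gcongr; exact min_le_right _ _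
        _ = ‖z‖ ^ (-((d : ℝ) + α - 2)) := by
          rw [← Real.rpow_natCast, ← Real.rpow_sub hz']; congr 1; push_cast; ring
  have h2 : IntegrableOn (fun z : EuclideanSpace ℝ (Fin d) =>
      min 1 (‖z‖ ^ 2) / ‖z‖ ^ ((d : ℝ) + α)) (Metric.ball 0 1)ᶜ := by
    have h3 : Integrable fun z : EuclideanSpace ℝ (Fin d) =>
        (2 : ℝ) ^ ((d : ℝ) + α) * (1 + ‖z‖) ^ (-((d : ℝ) + α)) :=
      (integrable_one_add_norm (by rw [hfr]; linarith)).const_mul _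
    refine Integrable.mono' h3.integrableOn hmeas.aestronglyMeasurable ?_
    filter_upwards [ae_restrict_mem Metric.isOpen_ball.measurableSet.compl] with z hz
    have hz' : 1 ≤ ‖z‖ := by simpa using hz
    rw [Real.norm_of_nonneg (by positivity), Real.rpow_neg (by positivity), ← div_eq_mul_inv,
      ← Real.div_rpow (by positivity) (by positivity)]
    calc _ ≤ 1 / ‖z‖ ^ ((d : ℝ) + α) := by gcongr; exact min_le_left _ _
      _ = (1 / ‖z‖) ^ ((d : ℝ) + α) := by
        rw [Real.div_rpow (by positivity) (by positivity), Real.one_rpow]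
      _ ≤ _ := by
        refine Real.rpow_le_rpow (by positivity) ?_ (by positivity)
        rw [div_le_div_iff₀ (by positivity) (by positivity)]
        linarith
  rw [← integrableOn_univ, ← Set.union_compl_self (Metric.ball (0 : EuclideanSpace ℝ (Fin d)) 1)]
  exact h1.union h2

variable [IsProbabilityMeasure (gibbs V)]

theorem integrable_comp_sub_prod {h : EuclideanSpace ℝ (Fin d) → ℝ} (hh : Integrable h)
    (hm : Measurable h) :
    Integrable (fun p : EuclideanSpace ℝ (Fin d) × EuclideanSpace ℝ (Fin d) => h (p.1 - p.2))
      ((gibbs V).prod volume) := by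
  rw [integrable_prod_iff (by
    have : Measurable fun p : EuclideanSpace ℝ (Fin d) × EuclideanSpace ℝ (Fin d) =>
      h (p.1 - p.2) := by fun_prop
    exact this.aestronglyMeasurable)]
  refine ⟨ae_of_all _ fun x => hh.comp_sub_left x, ?_⟩
  have : (fun x : EuclideanSpace ℝ (Fin d) => ∫ y, ‖h (x - y)‖) = fun _ => ∫ y, ‖h y‖ :=
    funext fun x => integral_sub_left_eq_self (fun y => ‖h y‖) volume x
  simp only [this]
  exact integrable_const _

theorem memLp_diffQuot (hd : 0 < d) (hα₀ : 0 < α) (hα₂ : α < 2)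
    {g : EuclideanSpace ℝ (Fin d) → ℝ} (hg : Measurable g) {L : ℝ≥0} (hL : LipschitzWith L g)
    {B : ℝ} (hB : ∀ x, |g x| ≤ B) : MemLp (diffQuot α g) 2 ((gibbs V).prod volume) := by
  rw [memLp_two_iff_integrable_sq (measurable_diffQuot hg).aestronglyMeasurable]
  refine Integrable.mono' ((integrable_comp_sub_prod (V := V)
    (integrable_min_one_sq_div hd hα₀ hα₂) (by fun_prop)).const_mul (max (L ^ 2) ((2 * B) ^ 2)))
    ((measurable_diffQuot hg).pow_const 2).aestronglyMeasurable (ae_of_all _ fun p => ?_)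
  rw [Real.norm_of_nonneg (sq_nonneg _), sq, ← kernel_eq_diffQuot_mul, kernel, ← sq, ← mul_div_assoc]
  gcongr
  have h1 : (g p.1 - g p.2) ^ 2 ≤ (2 * B) ^ 2 := by
    rw [sq_le_sq]
    refine (abs_sub _ _).trans ?_
    rw [abs_of_nonneg (a := 2 * B) (by linarith [hB 0, abs_nonneg (g 0)])]
    linarith [hB p.1, hB p.2]
  have h2 : (g p.1 - g p.2) ^ 2 ≤ L ^ 2 * ‖p.1 - p.2‖ ^ 2 := by
    rw [← mul_pow, sq_le_sq, abs_of_nonneg (a := (L : ℝ) * _) (by positivity)]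
    simpa [dist_eq_norm] using hL.dist_le_mul p.1 p.2
  rcases le_total 1 (‖p.1 - p.2‖ ^ 2) with h | h
  · rw [min_eq_left h, mul_one]
    exact h1.trans (le_max_right _ _)
  · rw [min_eq_right h]
    exact h2.trans (by gcongr; exact le_max_left _ _)

theorem dense_diffOp_domain (hd : 0 < d) (hα₀ : 0 < α) (hα₂ : α < 2) (hV : Measurable V) :
    Dense ((diffOp α hV).domain : Set (Lp ℝ 2 (gibbs V))) := by
  refine (Lp.dense_hasCompactSupport_contDiff (F := ℝ) (μ := gibbs V)
    (p := 2) (by simp)).mono ?_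
  rintro f ⟨g, hfg, hg, hgs⟩
  obtain ⟨L, hL⟩ := ContDiff.lipschitzWith_of_hasCompactSupport hg hgs (by simp)
  obtain ⟨B, hB⟩ := hg.exists_bound_of_continuous hgs.continuous
  exact (memLp_diffQuot hd hα₀ hα₂ hgs.continuous.measurable hL hB).ae_eq
    (diffQuot_congr hV hfg).symm

end StableLike

end

noncomputable section

namespace StableLike

theorem integral_sq_eq_norm_sq {X : Type*} [MeasurableSpace X] {μ : Measure X} (f : Lp ℝ 2 μ) : ∫ x, f x ^ 2 ∂μ = ‖f‖ ^ 2 := by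
  rw [← real_inner_self_eq_norm_sq, L2.inner_def]
  refine integral_congr_ae (ae_of_all _ fun x => ?_)
  simp [sq]

section LOne

variable {X : Type*} [MeasurableSpace X] {μ : Measure X} [IsProbabilityMeasure μ]

theorem integral_abs_eq_inner (f : Lp ℝ 2 μ) :
    ∫ x, |f x| ∂μ = inner ℝ |f| (Lp.const 2 μ (1 : ℝ)) := by
  rw [L2.inner_def]
  refine integral_congr_ae ?_
  filter_upwards [Lp.coeFn_abs f, Lp.coeFn_const (p := 2) (μ := μ) (1 : ℝ)] with x h1 h2
  rw [h1, h2, RCLike.inner_apply, conj_trivial]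
  simp

theorem continuous_integral_abs : Continuous fun f : Lp ℝ 2 μ => ∫ x, |f x| ∂μ := by
  simp only [integral_abs_eq_inner]
  have : Continuous fun f : Lp ℝ 2 μ => |f| := by
    unfold abs
    exact continuous_id.sup continuous_neg
  exact this.inner continuous_const

theorem inner_const_mono {f g : Lp ℝ 2 μ} (h : f ≤ g) :
    inner ℝ f (Lp.const 2 μ (1 : ℝ)) ≤ inner ℝ g (Lp.const 2 μ (1 : ℝ)) := by
  rw [← sub_nonneg, ← inner_sub_left, L2.inner_def]
  refine integral_nonneg_of_ae ?_
  filter_upwards [(Lp.coeFn_nonneg (g - f)).2 (sub_nonneg.2 h),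
    Lp.coeFn_const (p := 2) (μ := μ) (1 : ℝ)] with x h1 h2
  rw [h2, RCLike.inner_apply, conj_trivial]
  simpa using h1

theorem ae_le_of_forall_inner_le {f : Lp ℝ 2 μ} {M : ℝ}
    (h : ∀ g : Lp ℝ 2 μ, inner ℝ f g ≤ M * ∫ x, |g x| ∂μ) : ∀ᵐ x ∂μ, f x ≤ M := by
  refine ae_le_of_forall_setIntegral_le ((Lp.memLp f).integrable (by norm_num))
    (integrable_const M) fun s hs hμs => ?_
  have h1 := h (indicatorConstLp 2 hs hμs.ne 1)
  rw [real_inner_comm, L2.inner_indicatorConstLp_one] at h1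
  have h2 : ∫ x, |(indicatorConstLp 2 hs hμs.ne (1 : ℝ)) x| ∂μ = μ.real s := by
    rw [← integral_indicator_one hs]
    refine integral_congr_ae ?_
    filter_upwards [indicatorConstLp_coeFn (p := 2) (hs := hs) (hμs := hμs.ne) (c := (1 : ℝ))]
      with x hx
    rw [hx]
    by_cases hxs : x ∈ s <;> simp [hxs]
  rw [h2] at h1
  rw [setIntegral_const, smul_eq_mul, mul_comm]
  exact h1

theorem normL1Linf_le {T : Lp ℝ 2 μ →L[ℝ] Lp ℝ 2 μ} {M : ℝ}
    (h : ∀ f g : Lp ℝ 2 μ, inner ℝ (T f) g ≤ M * (∫ x, |f x| ∂μ) * ∫ x, |g x| ∂μ) (hM : 0 ≤ M) :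
    normL1Linf T ≤ ENNReal.ofReal M := by
  refine iSup₂_le fun f hf => ?_
  have hf1 : ∫ x, |f x| ∂μ ≤ 1 := by
    have h1 := integral_norm_eq_lintegral_enorm (Lp.aestronglyMeasurable f)
    rw [← eLpNorm_one_eq_lintegral_enorm] at h1
    simp only [Real.norm_eq_abs] at h1
    rw [h1]
    exact ENNReal.toReal_le_of_le_ofReal zero_le_one (by simpa using hf)
  have key : ∀ f : Lp ℝ 2 μ, ∫ x, |f x| ∂μ ≤ 1 → ∀ᵐ x ∂μ, T f x ≤ M := by
    intro f hf
    refine ae_le_of_forall_inner_le fun g => (h f g).trans ?_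
    have h0 : 0 ≤ ∫ x, |g x| ∂μ := integral_nonneg fun x => abs_nonneg _
    refine mul_le_mul_of_nonneg_right ?_ h0
    exact mul_le_of_le_one_right hM hf
  have hneg : ∫ x, |(-f : Lp ℝ 2 μ) x| ∂μ ≤ 1 := by
    rw [integral_abs_eq_inner] at hf1 ⊢
    rwa [abs_neg]
  rw [eLpNorm_exponent_top]
  refine eLpNormEssSup_le_of_ae_bound ?_
  have hneg2 := key _ hneg
  rw [map_neg] at hneg2
  filter_upwards [key f hf1, hneg2, Lp.coeFn_neg (T f)] with x h1 h2 h3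
  rw [h3, Pi.neg_apply] at h2
  exact abs_le.2 ⟨by linarith, h1⟩

end LOne

namespace IsAssociatedSemigroup

variable {d : ℕ} {α : ℝ} {V : EuclideanSpace ℝ (Fin d) → ℝ}
  {P : ℝ≥0 → Lp ℝ 2 (gibbs V) →L[ℝ] Lp ℝ 2 (gibbs V)}

theorem abs_apply_le (hP : IsAssociatedSemigroup α V P) (t : ℝ≥0) (f : Lp ℝ 2 (gibbs V)) :
    |P t f| ≤ P t |f| := by
  have hpos : ∀ g : Lp ℝ 2 (gibbs V), 0 ≤ g → 0 ≤ P t g := fun g hg =>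
    (Lp.coeFn_nonneg _).1 (hP.positive t g ((Lp.coeFn_nonneg g).2 hg))
  rw [abs_le']
  constructor
  · have := hpos (|f| - f) (sub_nonneg.2 (le_abs_self f))
    rwa [map_sub, sub_nonneg] at this
  · have := hpos (|f| - -f) (sub_nonneg.2 (neg_le_abs f))
    rwa [map_sub, map_neg, sub_nonneg] at this

variable [IsProbabilityMeasure (gibbs V)]

theorem integral_abs_apply_le (hP : IsAssociatedSemigroup α V P) (t : ℝ≥0)
    (f : Lp ℝ 2 (gibbs V)) : ∫ x, |P t f x| ∂gibbs V ≤ ∫ x, |f x| ∂gibbs V := by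
  have hone : P t (Lp.const 2 _ (1 : ℝ)) = Lp.const 2 _ (1 : ℝ) := by
    have hc := Lp.coeFn_const (p := 2) (μ := gibbs V) (1 : ℝ)
    refine Lp.ext ?_
    filter_upwards [hP.map_one t _ hc, hc] with x h1 h2
    rw [h1, h2]
    rfl
  rw [integral_abs_eq_inner, integral_abs_eq_inner]
  refine (inner_const_mono (hP.abs_apply_le t f)).trans_eq ?_
  rw [hP.symmetric, hone]

theorem norm_sq_le (hV : Measurable V) (hd : Dense ((diffOp α hV).domain : Set (Lp ℝ 2 (gibbs V))))
    (hP : IsAssociatedSemigroup α V P) {β : ℝ → ℝ} (hβ : SuperPoincare α V β) {r : ℝ}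
    (hr : 0 < r) (hβr : 0 ≤ β r) (t : ℝ≥0) (f : Lp ℝ 2 (gibbs V)) :
    ‖P t f‖ ^ 2 ≤ Real.exp (-(2 / r) * t) * ‖f‖ ^ 2 + β r * (∫ x, |f x| ∂gibbs V) ^ 2 := by
  refine (hP.isFormSemigroup hV).norm_sq_le (isClosed_diffOp hV) hd continuous_integral_abs
    (fun f => integral_nonneg fun x => abs_nonneg _) hP.integral_abs_apply_le hr hβr
    (fun u => ?_) t f
  have h := hβ r hr u ((mem_diffOp_domain_iff hV).1 u.2)
  rwa [integral_sq_eq_norm_sq, ← inner_diffOp, real_inner_self_eq_norm_sq] at h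

theorem norm_sq_le_of_doubling (hV : Measurable V)
    (hd : Dense ((diffOp α hV).domain : Set (Lp ℝ 2 (gibbs V))))
    (hP : IsAssociatedSemigroup α V P) {β : ℝ → ℝ} (hβ : SuperPoincare α V β)
    (hβ0 : ∀ r, 0 < r → 0 ≤ β r) {D θ : ℝ} (hD : ∀ r, 0 < r → β (r / 2) ≤ D * β r)
    (hθ : 0 < θ) (hθD : Real.exp (-θ⁻¹) * D ≤ 1 / 2) {t : ℝ≥0} (ht : 0 < t)
    (f : Lp ℝ 2 (gibbs V)) :
    ‖P t f‖ ^ 2 ≤ 2 * β (θ * t) * (∫ x, |f x| ∂gibbs V) ^ 2 := by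
  set N := (∫ x, |f x| ∂gibbs V) ^ 2 with hN
  have hN0 : 0 ≤ N := sq_nonneg _
  set q := Real.exp (-θ⁻¹) with hq
  have hq0 : 0 < q := Real.exp_pos _
  have hq1 : q < 1 := by
    rw [hq, Real.exp_lt_one_iff]
    simpa using hθ
  have step : ∀ n : ℕ, ∀ t : ℝ≥0, 0 < t →
      ‖P t f‖ ^ 2 ≤ q ^ n * ‖f‖ ^ 2 + 2 * β (θ * t) * N := by
    intro n
    induction n with
    | zero =>
      intro t ht
      have h1 := (hP.isFormSemigroup hV).norm_apply_le t f
      have h2 := hβ0 (θ * t) (mul_pos hθ (NNReal.coe_pos.2 ht))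
      have h3 : ‖P t f‖ ^ 2 ≤ ‖f‖ ^ 2 := by gcongr
      rw [pow_zero, one_mul]
      nlinarith
    | succ n ih =>
      intro t ht
      have ht' : (0 : ℝ) < t := NNReal.coe_pos.2 ht
      have hr : 0 < θ * t := mul_pos hθ ht'
      have h1 := hP.norm_sq_le hV hd hβ hr (hβ0 _ hr) (t / 2) (P (t / 2) f)
      have e1 : P (t / 2) (P (t / 2) f) = P t f := by
        rw [← ContinuousLinearMap.comp_apply, ← hP.map_add, add_halves]
      have e2 : -(2 / (θ * t)) * ((t / 2 : ℝ≥0) : ℝ) = -θ⁻¹ := by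
        push_cast
        field_simp
      rw [e1, e2, ← hq] at h1
      have h2 : (∫ x, |P (t / 2) f x| ∂gibbs V) ^ 2 ≤ N := by
        exact pow_le_pow_left₀ (integral_nonneg fun x => abs_nonneg _)
          (hP.integral_abs_apply_le _ _) 2
      have h3 := ih (t / 2) (by positivity)
      have h4 := hD _ hr
      have e3 : θ * ((t / 2 : ℝ≥0) : ℝ) = θ * t / 2 := by push_cast; ring
      rw [e3] at h3
      have hb := hβ0 _ hr
      calc ‖P t f‖ ^ 2 ≤ q * ‖P (t / 2) f‖ ^ 2 + β (θ * t) * N := by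
            refine h1.trans ?_
            gcongr
        _ ≤ q * (q ^ n * ‖f‖ ^ 2 + 2 * (D * β (θ * t)) * N) + β (θ * t) * N := by
            gcongr
            refine h3.trans ?_
            gcongr
        _ = q ^ (n + 1) * ‖f‖ ^ 2 + (2 * (q * D) + 1) * (β (θ * t) * N) := by ring
        _ ≤ q ^ (n + 1) * ‖f‖ ^ 2 + (2 * (1 / 2) + 1) * (β (θ * t) * N) := by gcongr
        _ = _ := by ring
  have hlim : Tendsto (fun n : ℕ => q ^ n * ‖f‖ ^ 2 + 2 * β (θ * t) * N) atTop
      (𝓝 (0 * ‖f‖ ^ 2 + 2 * β (θ * t) * N)) :=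
    ((tendsto_pow_atTop_nhds_zero_of_lt_one hq0.le hq1).mul_const _).add_const _
  rw [zero_mul, zero_add] at hlim
  exact ge_of_tendsto hlim (Eventually.of_forall fun n => step n t ht)

end IsAssociatedSemigroup

theorem exists_exp_neg_two_pow_mul_le (D : ℝ) :
    ∃ m : ℕ, Real.exp (-(2 : ℝ) ^ m) * D ≤ 1 / 2 := by
  have h1 : Tendsto (fun m : ℕ => Real.exp (-(2 : ℝ) ^ m) * D) atTop (𝓝 (0 * D)) :=
    ((Real.tendsto_exp_neg_atTop_nhds_zero.comp
      (tendsto_pow_atTop_atTop_of_one_lt one_lt_two)).mul_const D)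
  rw [zero_mul] at h1
  exact (h1.eventually_le_const (by norm_num)).exists

/-- A super Poincaré inequality with a doubling rate `β` gives the bound
`‖P_t‖_{L¹ → L^∞} ≤ C β(t)`, where `C` depends only on the doubling constant. -/
theorem exists_normL1Linf_le {d : ℕ} {α : ℝ} {V : EuclideanSpace ℝ (Fin d) → ℝ}
    [IsProbabilityMeasure (gibbs V)] (hV : Measurable V)
    (hd : Dense ((diffOp α hV).domain : Set (Lp ℝ 2 (gibbs V)))) {β : ℝ → ℝ}
    (hβ : SuperPoincare α V β) (hβ0 : ∀ r, 0 < r → 0 ≤ β r) {D : ℝ} (hD1 : 1 ≤ D)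
    (hD : ∀ r, 0 < r → β (r / 2) ≤ D * β r) :
    ∃ C : ℝ, 1 ≤ C ∧ ∀ P, IsAssociatedSemigroup α V P → ∀ t : ℝ≥0, 0 < t →
      normL1Linf (P t) ≤ ENNReal.ofReal (C * β t) := by
  obtain ⟨m, hm⟩ := exists_exp_neg_two_pow_mul_le D
  have hDm : 1 ≤ D ^ (m + 1) := one_le_pow₀ hD1
  refine ⟨2 * D ^ (m + 1), by linarith, fun P hP t ht => ?_⟩
  have ht' : (0 : ℝ) < t := NNReal.coe_pos.2 ht
  have hpow : ∀ n : ℕ, ∀ r : ℝ, 0 < r → β (r / 2 ^ n) ≤ D ^ n * β r := by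
    intro n
    induction n with
    | zero => simp
    | succ n ih =>
      intro r hr
      have h1 := hD (r / 2 ^ n) (by positivity)
      rw [div_div, ← pow_succ] at h1
      refine h1.trans ?_
      rw [pow_succ', mul_assoc]
      gcongr
      exact ih r hr
  have hθ : ((2 : ℝ) ^ m)⁻¹ * ((t / 2 : ℝ≥0) : ℝ) = t / 2 ^ (m + 1) := by
    push_cast
    rw [pow_succ]
    field_simp
  have hhalf : ∀ f : Lp ℝ 2 (gibbs V), ‖P (t / 2) f‖ ≤
      Real.sqrt (2 * D ^ (m + 1) * β t) * ∫ x, |f x| ∂gibbs V := by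
    intro f
    have h1 := hP.norm_sq_le_of_doubling hV hd hβ hβ0 hD (θ := ((2 : ℝ) ^ m)⁻¹) (by positivity)
      (by rwa [inv_inv]) (t := t / 2) (by positivity) f
    rw [hθ] at h1
    have h0 : 0 ≤ ∫ x, |f x| ∂gibbs V := integral_nonneg fun x => abs_nonneg _
    have h2 := hβ0 t ht'
    refine abs_le_of_sq_le_sq' ?_ (by positivity) |>.2
    rw [mul_pow, Real.sq_sqrt (by positivity)]
    refine h1.trans ?_
    have h3 := mul_le_mul_of_nonneg_right (hpow (m + 1) t ht')
      (sq_nonneg (∫ x, |f x| ∂gibbs V))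
    linarith
  refine normL1Linf_le (fun f g => ?_) (mul_nonneg (by positivity) (hβ0 _ ht'))
  have e1 : P t f = P (t / 2) (P (t / 2) f) := by
    rw [← ContinuousLinearMap.comp_apply, ← hP.map_add, add_halves]
  rw [e1, hP.symmetric]
  refine (real_inner_le_norm _ _).trans ((mul_le_mul (hhalf f) (hhalf g) (norm_nonneg _)
    (mul_nonneg (Real.sqrt_nonneg _) (integral_nonneg fun x => abs_nonneg _))).trans_eq ?_)
  have h2 := hβ0 t ht'
  rw [mul_mul_mul_comm, Real.mul_self_sqrt (by positivity)]
  ring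

end StableLike

end

noncomputable section

theorem MeasureTheory.sq_setLIntegral_le {X : Type*} [MeasurableSpace X] {μ : Measure X} (B : Set X)
    {g : X → ℝ≥0∞} (hg : Measurable g) :
    (∫⁻ y in B, g y ∂μ) ^ 2 ≤ μ B * ∫⁻ y in B, g y ^ 2 ∂μ := by
  have h := ENNReal.lintegral_mul_le_Lp_mul_Lq (μ.restrict B) Real.HolderConjugate.two_two
    (f := fun _ => 1) (g := g) aemeasurable_const hg.aemeasurable
  simp only [Pi.mul_apply, one_mul, one_pow, lintegral_const, Measure.restrict_apply,
    MeasurableSet.univ, Set.univ_inter, ENNReal.rpow_ofNat] at h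
  calc _ ≤ (μ B ^ (1 / 2 : ℝ) * (∫⁻ y in B, g y ^ 2 ∂μ) ^ (1 / 2 : ℝ)) ^ 2 := by gcongr
    _ = _ := by
      rw [mul_pow, ← ENNReal.rpow_natCast, ← ENNReal.rpow_natCast, ← ENNReal.rpow_mul,
        ← ENNReal.rpow_mul]
      norm_num

theorem ENNReal.add_sq_le_two_mul (a b : ℝ≥0∞) : (a + b) ^ 2 ≤ 2 * a ^ 2 + 2 * b ^ 2 := by
  have h := ENNReal.rpow_add_le_mul_rpow_add_rpow a b (p := 2) (by norm_num)
  norm_num at h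
  rw [mul_add] at h
  simpa [← ENNReal.rpow_ofNat] using h

theorem MeasureTheory.enorm_sq_mul_sq_le {X : Type*} [MeasurableSpace X] {μ : Measure X} (B : Set X)
    {f : X → ℝ} (hf : Measurable f) (c : ℝ) :
    ‖c‖ₑ ^ 2 * μ B ^ 2 ≤
      2 * (μ B * ∫⁻ y in B, ‖c - f y‖ₑ ^ 2 ∂μ) + 2 * (∫⁻ y in B, ‖f y‖ₑ ∂μ) ^ 2 := by
  have h1 : ‖c‖ₑ * μ B ≤ ∫⁻ y in B, ‖c - f y‖ₑ ∂μ + ∫⁻ y in B, ‖f y‖ₑ ∂μ := by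
    rw [← setLIntegral_const, ← lintegral_add_right _ hf.enorm]
    refine lintegral_mono fun y => ?_
    simpa using enorm_add_le (c - f y) (f y)
  rw [← mul_pow]
  calc _ ≤ (∫⁻ y in B, ‖c - f y‖ₑ ∂μ + ∫⁻ y in B, ‖f y‖ₑ ∂μ) ^ 2 := by gcongr
    _ ≤ 2 * (∫⁻ y in B, ‖c - f y‖ₑ ∂μ) ^ 2 + 2 * (∫⁻ y in B, ‖f y‖ₑ ∂μ) ^ 2 :=
      ENNReal.add_sq_le_two_mul _ _
    _ ≤ _ := by
      gcongr
      exact sq_setLIntegral_le B (by fun_prop)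

namespace StableLike

variable {d : ℕ} {α : ℝ} {V : EuclideanSpace ℝ (Fin d) → ℝ}

/-- The normalising constant `∫ e^{-V(x)} dx`. -/
def partition (V : EuclideanSpace ℝ (Fin d) → ℝ) : ℝ≥0∞ :=
  ∫⁻ x, ENNReal.ofReal (Real.exp (-V x))

theorem lintegral_gibbs (hV : Measurable V) {F : EuclideanSpace ℝ (Fin d) → ℝ≥0∞}
    (hF : Measurable F) :
    ∫⁻ x, F x ∂gibbs V = (partition V)⁻¹ * ∫⁻ x, ENNReal.ofReal (Real.exp (-V x)) * F x := by
  rw [gibbs, lintegral_smul_measure, lintegral_withDensity_eq_lintegral_mul _ (by fun_prop) hF]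
  rfl

theorem setLIntegral_gibbs (hV : Measurable V) {F : EuclideanSpace ℝ (Fin d) → ℝ≥0∞}
    (hF : Measurable F) {s : Set (EuclideanSpace ℝ (Fin d))} (hs : MeasurableSet s) :
    ∫⁻ x in s, F x ∂gibbs V =
      (partition V)⁻¹ * ∫⁻ x in s, ENNReal.ofReal (Real.exp (-V x)) * F x := by
  rw [← lintegral_indicator hs, lintegral_gibbs hV (hF.indicator hs), ← lintegral_indicator hs]
  congr 2 with x
  by_cases hx : x ∈ s <;> simp [hx]

theorem partition_ne_top [IsProbabilityMeasure (gibbs V)] : partition V ≠ ∞ :=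
  lintegral_ne_top_of_gibbs

theorem partition_ne_zero [h : IsProbabilityMeasure (gibbs V)] : partition V ≠ 0 := by
  intro h1
  have h2 := h.measure_univ
  rw [gibbs, Measure.smul_apply, withDensity_apply _ MeasurableSet.univ, setLIntegral_univ] at h2
  change (partition V)⁻¹ • partition V = 1 at h2
  simp [h1] at h2

theorem measurable_kernel {f : EuclideanSpace ℝ (Fin d) → ℝ} (hf : Measurable f) :
    Measurable (kernel α f f) := by
  unfold kernel
  fun_prop

theorem enorm_sub_sq_le (hα₀ : 0 < α) (f : EuclideanSpace ℝ (Fin d) → ℝ)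
    {x y : EuclideanSpace ℝ (Fin d)} {ρ : ℝ} (h : ‖x - y‖ ≤ ρ) :
    ‖f x - f y‖ₑ ^ 2 ≤ ENNReal.ofReal (ρ ^ ((d : ℝ) + α)) * ENNReal.ofReal (kernel α f f (x, y)) := by
  have hρ : 0 ≤ ρ := (norm_nonneg _).trans h
  rw [Real.enorm_eq_ofReal_abs, ← ENNReal.ofReal_pow (abs_nonneg _), sq_abs,
    ← ENNReal.ofReal_mul (by positivity)]
  refine ENNReal.ofReal_le_ofReal ?_
  rcases eq_or_ne x y with rfl | hxy
  · simpa using mul_nonneg (Real.rpow_nonneg hρ _) (kernel_self_nonneg f _)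
  · have h0 : 0 < ‖x - y‖ := norm_pos_iff.2 (sub_ne_zero.2 hxy)
    have h1 : ‖x - y‖ ^ ((d : ℝ) + α) ≤ ρ ^ ((d : ℝ) + α) :=
      Real.rpow_le_rpow h0.le h (by positivity)
    have h2 : 0 < ‖x - y‖ ^ ((d : ℝ) + α) := Real.rpow_pos_of_pos h0 _
    calc (f x - f y) ^ 2 = ‖x - y‖ ^ ((d : ℝ) + α) * kernel α f f (x, y) := by
          rw [kernel]; field_simp
      _ ≤ _ := mul_le_mul_of_nonneg_right h1 (kernel_self_nonneg f _)

variable [IsProbabilityMeasure (gibbs V)]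

theorem setLIntegral_enorm_le (hV : Measurable V) {f : EuclideanSpace ℝ (Fin d) → ℝ}
    (hf : Measurable f) {B : Set (EuclideanSpace ℝ (Fin d))} {w : ℝ} (hw : ∀ y ∈ B, V y ≤ w) :
    ∫⁻ y in B, ‖f y‖ₑ ≤
      ENNReal.ofReal (Real.exp w) * (partition V * ∫⁻ y, ‖f y‖ₑ ∂gibbs V) := by
  rw [lintegral_gibbs hV hf.enorm, ← mul_assoc (partition V), ENNReal.mul_inv_cancel
    partition_ne_zero partition_ne_top,
    one_mul, ← lintegral_const_mul _ (by fun_prop)]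
  refine (setLIntegral_mono (by fun_prop) fun y hy => ?_).trans (setLIntegral_le_lintegral B _)
  rw [← mul_assoc, ← ENNReal.ofReal_mul (Real.exp_pos _).le, ← Real.exp_add]
  have : (1 : ℝ≥0∞) ≤ ENNReal.ofReal (Real.exp (w + -V y)) := by
    rw [ENNReal.one_le_ofReal, Real.one_le_exp_iff]
    linarith [hw y hy]
  exact le_mul_of_one_le_left' this

theorem setLIntegral_closedBall_le (hα₀ : 0 < α) (hV : Measurable V) {f : EuclideanSpace ℝ (Fin d) → ℝ} (hf : Measurable f) {δ R w : ℝ}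
    (hδ : 0 < δ) (hδR : δ ≤ R) (hw : ∀ y, ‖y‖ ≤ R → V y ≤ w) :
    (∫⁻ x in Metric.closedBall 0 R, ‖f x‖ₑ ^ 2 ∂gibbs V) *
        volume (Metric.ball (0 : EuclideanSpace ℝ (Fin d)) δ) ^ 2 ≤
      2 * (volume (Metric.ball (0 : EuclideanSpace ℝ (Fin d)) δ) *
        (ENNReal.ofReal ((2 * δ) ^ ((d : ℝ) + α)) *
          ∫⁻ p, ENNReal.ofReal (kernel α f f p) ∂(gibbs V).prod volume)) +
      2 * (ENNReal.ofReal (Real.exp w) * (partition V * ∫⁻ y, ‖f y‖ₑ ∂gibbs V)) ^ 2 := by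
  set v := volume (Metric.ball (0 : EuclideanSpace ℝ (Fin d)) δ) with hv
  set N := ENNReal.ofReal (Real.exp w) * (partition V * ∫⁻ y, ‖f y‖ₑ ∂gibbs V) with hN
  set c := ENNReal.ofReal ((2 * δ) ^ ((d : ℝ) + α)) with hc
  have hR : 0 < R := hδ.trans_le hδR
  have hk : Measurable fun p : EuclideanSpace ℝ (Fin d) × EuclideanSpace ℝ (Fin d) =>
      ENNReal.ofReal (kernel α f f p) := (measurable_kernel hf).ennreal_ofReal
  have hkx : ∀ x, Measurable fun y => ENNReal.ofReal (kernel α f f (x, y)) := fun x =>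
    hk.comp measurable_prodMk_left
  have hpt : ∀ x ∈ Metric.closedBall (0 : EuclideanSpace ℝ (Fin d)) R, ‖f x‖ₑ ^ 2 * v ^ 2 ≤
      2 * (v * (c * ∫⁻ y, ENNReal.ofReal (kernel α f f (x, y)))) + 2 * N ^ 2 := by
    intro x hx
    rw [mem_closedBall_zero_iff] at hx
    set B := Metric.ball ((1 - δ / R) • x) δ with hB
    have hBv : volume B = v := by
      rw [hB, hv, Measure.addHaar_ball_center]
    have h01 : 0 ≤ 1 - δ / R := by
      rw [sub_nonneg, div_le_one hR]; exact hδR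
    have hBR : ∀ y ∈ B, ‖y‖ ≤ R := by
      intro y hy
      rw [hB, mem_ball_iff_norm] at hy
      have h1 : ‖(1 - δ / R) • x‖ ≤ R - δ := by
        rw [norm_smul, Real.norm_of_nonneg h01]
        calc _ ≤ (1 - δ / R) * R := by gcongr
          _ = R - δ := by field_simp
      have h2 := norm_add_le (y - (1 - δ / R) • x) ((1 - δ / R) • x)
      rw [sub_add_cancel] at h2
      linarith
    have hBx : ∀ y ∈ B, ‖x - y‖ ≤ 2 * δ := by
      intro y hy
      rw [hB, mem_ball_iff_norm'] at hy
      have h1 : ‖(δ / R) • x‖ ≤ δ := by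
        rw [norm_smul, Real.norm_of_nonneg (by positivity)]
        calc _ ≤ δ / R * R := by gcongr
          _ = δ := by field_simp
      have h2 := norm_add_le ((δ / R) • x) ((1 - δ / R) • x - y)
      have e : (δ / R) • x + ((1 - δ / R) • x - y) = x - y := by module
      rw [e] at h2
      linarith
    have h := enorm_sq_mul_sq_le (μ := volume) B hf (f x)
    rw [hBv] at h
    refine h.trans ?_
    gcongr
    · rw [← lintegral_const_mul _ (by fun_prop)]
      refine (setLIntegral_mono (by fun_prop) fun y hy => ?_).trans (setLIntegral_le_lintegral B _)
      exact enorm_sub_sq_le hα₀ f (hBx y hy)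
    · exact setLIntegral_enorm_le hV hf
        fun y hy => hw y (hBR y hy)
  have hmeas : Measurable fun x => ∫⁻ y, ENNReal.ofReal (kernel α f f (x, y)) :=
    hk.lintegral_prod_right'
  rw [← lintegral_mul_const _ (by fun_prop), lintegral_prod _ hk.aemeasurable]
  calc _ ≤ ∫⁻ x in Metric.closedBall 0 R,
        (2 * (v * (c * ∫⁻ y, ENNReal.ofReal (kernel α f f (x, y)))) + 2 * N ^ 2) ∂gibbs V :=
        setLIntegral_mono (by fun_prop) hpt
    _ ≤ ∫⁻ x, (2 * (v * (c * ∫⁻ y, ENNReal.ofReal (kernel α f f (x, y)))) + 2 * N ^ 2) ∂gibbs V :=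
        setLIntegral_le_lintegral _ _
    _ = _ := by
        rw [lintegral_add_right _ measurable_const, lintegral_const, measure_univ, mul_one,
          lintegral_const_mul _ (by fun_prop), lintegral_const_mul _ (by fun_prop),
          lintegral_const_mul _ hmeas]

theorem setLIntegral_compl_closedBall_le (hα₀ : 0 < α) (hV : Measurable V) {f : EuclideanSpace ℝ (Fin d) → ℝ} (hf : Measurable f) {R w S : ℝ}
    (hw : ∀ y, ‖y‖ ≤ 1 → V y ≤ w) (hS0 : 0 ≤ S)
    (hS : ∀ x, R < ‖x‖ → Real.exp (-V x) * (1 + ‖x‖) ^ ((d : ℝ) + α) ≤ S) :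
    (∫⁻ x in (Metric.closedBall 0 R)ᶜ, ‖f x‖ₑ ^ 2 ∂gibbs V) *
        volume (Metric.ball (0 : EuclideanSpace ℝ (Fin d)) 1) ^ 2 ≤
      2 * (volume (Metric.ball (0 : EuclideanSpace ℝ (Fin d)) 1) *
        (ENNReal.ofReal (S * Real.exp w) *
          ∫⁻ p, ENNReal.ofReal (kernel α f f p) ∂(gibbs V).prod volume)) +
      2 * (ENNReal.ofReal (Real.exp w) * (partition V * ∫⁻ y, ‖f y‖ₑ ∂gibbs V)) ^ 2 := by
  set B := Metric.ball (0 : EuclideanSpace ℝ (Fin d)) 1 with hB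
  set v := volume B with hv
  set N := ENNReal.ofReal (Real.exp w) * (partition V * ∫⁻ y, ‖f y‖ₑ ∂gibbs V) with hN
  have hBm : MeasurableSet B := Metric.isOpen_ball.measurableSet
  have hBw : ∀ y ∈ B, V y ≤ w := fun y hy => hw y (mem_ball_zero_iff.1 hy).le
  have hAm : MeasurableSet (Metric.closedBall (0 : EuclideanSpace ℝ (Fin d)) R)ᶜ :=
    Metric.isClosed_closedBall.measurableSet.compl
  have hk : Measurable fun p : EuclideanSpace ℝ (Fin d) × EuclideanSpace ℝ (Fin d) =>
      ENNReal.ofReal (kernel α f f p) := (measurable_kernel hf).ennreal_ofReal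
  have hD : Measurable fun x => ∫⁻ y in B, ‖f x - f y‖ₑ ^ 2 := by
    have : Measurable fun p : EuclideanSpace ℝ (Fin d) × EuclideanSpace ℝ (Fin d) =>
      ‖f p.1 - f p.2‖ₑ ^ 2 := by fun_prop
    exact this.lintegral_prod_right'
  have hkx : ∀ x, Measurable fun y => ENNReal.ofReal (kernel α f f (x, y)) := fun x =>
    hk.comp measurable_prodMk_left
  have hpt : ∀ x, ‖f x‖ₑ ^ 2 * v ^ 2 ≤
      2 * (v * ∫⁻ y in B, ‖f x - f y‖ₑ ^ 2) + 2 * N ^ 2 := by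
    intro x
    refine (enorm_sq_mul_sq_le (μ := volume) B hf (f x)).trans ?_
    gcongr
    exact setLIntegral_enorm_le hV hf hBw
  have hsymm : ∀ x y, kernel α f f (x, y) = kernel α f f (y, x) := by
    intro x y
    simp only [kernel]
    rw [norm_sub_rev x y]
    ring
  have hjump : ∫⁻ x in (Metric.closedBall 0 R)ᶜ, (∫⁻ y in B, ‖f x - f y‖ₑ ^ 2) ∂gibbs V ≤
      ENNReal.ofReal (S * Real.exp w) *
        ∫⁻ p, ENNReal.ofReal (kernel α f f p) ∂(gibbs V).prod volume := by
    rw [setLIntegral_gibbs hV hD hAm, lintegral_prod _ hk.aemeasurable,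
      lintegral_gibbs hV hk.lintegral_prod_right', ← mul_assoc, mul_comm (ENNReal.ofReal _),
      mul_assoc]
    gcongr
    have hswap : ∫⁻ x, ENNReal.ofReal (Real.exp (-V x)) * ∫⁻ y, ENNReal.ofReal (kernel α f f (x, y))
        = ∫⁻ x, ∫⁻ y, ENNReal.ofReal (Real.exp (-V y)) * ENNReal.ofReal (kernel α f f (x, y)) := by
      rw [lintegral_lintegral_swap (by
        have : Measurable fun p : EuclideanSpace ℝ (Fin d) × EuclideanSpace ℝ (Fin d) =>
          ENNReal.ofReal (Real.exp (-V p.2)) * ENNReal.ofReal (kernel α f f p) := by fun_prop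
        exact this.aemeasurable)]
      refine lintegral_congr fun y => ?_
      simp only [fun x => hsymm x y]
      rw [lintegral_const_mul _ (hkx y)]
    have hM : Measurable fun p : EuclideanSpace ℝ (Fin d) × EuclideanSpace ℝ (Fin d) =>
        ENNReal.ofReal (Real.exp (-V p.2)) * ENNReal.ofReal (kernel α f f p) := by fun_prop
    rw [hswap, ← lintegral_const_mul _ hM.lintegral_prod_right']
    refine (setLIntegral_mono (by
      exact (hM.lintegral_prod_right').const_mul _) fun x hx => ?_).trans
      (setLIntegral_le_lintegral _ _)
    have hx' : R < ‖x‖ := by simpa using hx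
    rw [← lintegral_const_mul _ (by fun_prop), ← lintegral_const_mul _ (by fun_prop)]
    refine (setLIntegral_mono (by fun_prop) fun y hy => ?_).trans (setLIntegral_le_lintegral _ _)
    have hy' := mem_ball_zero_iff.1 hy
    have hxy : ‖x - y‖ ≤ 1 + ‖x‖ := (norm_sub_le x y).trans (by linarith)
    calc _ ≤ ENNReal.ofReal (Real.exp (-V x)) * (ENNReal.ofReal ((1 + ‖x‖) ^ ((d : ℝ) + α)) *
          ENNReal.ofReal (kernel α f f (x, y))) := by
          gcongr
          exact enorm_sub_sq_le hα₀ f hxy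
      _ = ENNReal.ofReal (Real.exp (-V x) * (1 + ‖x‖) ^ ((d : ℝ) + α)) *
          ENNReal.ofReal (kernel α f f (x, y)) := by
          rw [← mul_assoc, ← ENNReal.ofReal_mul (Real.exp_pos _).le]
      _ ≤ ENNReal.ofReal (S * Real.exp w * Real.exp (-V y)) *
          ENNReal.ofReal (kernel α f f (x, y)) := by
          refine mul_le_mul' (ENNReal.ofReal_le_ofReal ?_) le_rfl
          refine (hS x hx').trans ?_
          rw [mul_assoc, ← Real.exp_add]
          exact le_mul_of_one_le_right hS0 (Real.one_le_exp (by linarith [hBw y hy]))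
      _ = _ := by rw [ENNReal.ofReal_mul (by positivity), mul_assoc]
  rw [← lintegral_mul_const _ (by fun_prop)]
  calc _ ≤ ∫⁻ x in (Metric.closedBall 0 R)ᶜ,
        (2 * (v * ∫⁻ y in B, ‖f x - f y‖ₑ ^ 2) + 2 * N ^ 2) ∂gibbs V :=
        lintegral_mono hpt
    _ = 2 * (v * ∫⁻ x in (Metric.closedBall 0 R)ᶜ, (∫⁻ y in B, ‖f x - f y‖ₑ ^ 2) ∂gibbs V) +
        2 * N ^ 2 * gibbs V (Metric.closedBall 0 R)ᶜ := by
        rw [lintegral_add_right _ measurable_const, setLIntegral_const,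
          lintegral_const_mul _ (by fun_prop), lintegral_const_mul _ hD]
    _ ≤ _ := by
        refine add_le_add ?_ (mul_le_of_le_one_right zero_le prob_le_one)
        gcongr

end StableLike

end

noncomputable section

namespace StableLike

variable {d : ℕ} {α : ℝ} {V : EuclideanSpace ℝ (Fin d) → ℝ}

theorem integral_sq_eq_toReal {X : Type*} [MeasurableSpace X] {ν : Measure X} {f : X → ℝ}
    (hf : Measurable f) : ∫ x, f x ^ 2 ∂ν = (∫⁻ x, ‖f x‖ₑ ^ 2 ∂ν).toReal := by
  rw [integral_eq_lintegral_of_nonneg_ae (ae_of_all _ fun x => sq_nonneg _)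
    (hf.pow_const 2).aestronglyMeasurable]
  congr 2 with x
  rw [Real.enorm_eq_ofReal_abs, ← ENNReal.ofReal_pow (abs_nonneg _), sq_abs]

theorem mul_sq_le_of_ennreal {a v c e b z m : ℝ≥0∞}
    (h : a * v ^ 2 ≤ 2 * (v * (c * e)) + 2 * (b * (z * m)) ^ 2) (hv : v ≠ ∞) (hc : c ≠ ∞)
    (he : e ≠ ∞) (hb : b ≠ ∞) (hz : z ≠ ∞) (hm : m ≠ ∞) :
    a.toReal * v.toReal ^ 2 ≤ 2 * (v.toReal * (c.toReal * e.toReal)) +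
      2 * (b.toReal * (z.toReal * m.toReal)) ^ 2 := by
  have h1 : 2 * (v * (c * e)) ≠ ∞ := by finiteness
  have h2 : 2 * (b * (z * m)) ^ 2 ≠ ∞ := by finiteness
  have := ENNReal.toReal_mono (by finiteness) h
  rw [ENNReal.toReal_add h1 h2] at this
  simpa using this

variable [IsProbabilityMeasure (gibbs V)]

/-- The super Poincaré inequality before optimisation over the averaging radius `δ` and the
truncation radius `R`. -/
theorem exists_integral_sq_le (hα₀ : 0 < α) (hV : Measurable V) {w₁ : ℝ}
    (hw₁ : ∀ y, ‖y‖ ≤ 1 → V y ≤ w₁) :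
    ∃ C : ℝ, 0 < C ∧ ∀ δ R w S : ℝ, 0 < δ → δ ≤ R → (∀ y, ‖y‖ ≤ R → V y ≤ w) → 0 ≤ S →
      (∀ x, R < ‖x‖ → Real.exp (-V x) * (1 + ‖x‖) ^ ((d : ℝ) + α) ≤ S) →
      ∀ f ∈ formDomain α V, ∫ x, f x ^ 2 ∂(gibbs V) ≤
        C * (δ ^ α + S) * form α V f f +
          C * (1 + (Real.exp w / δ ^ d) ^ 2) * (∫ x, |f x| ∂(gibbs V)) ^ 2 := by
  set s := (d : ℝ) + α with hs
  set ω := (volume (Metric.ball (0 : EuclideanSpace ℝ (Fin d)) 1)).toReal with hω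
  set z := (partition V).toReal with hz
  have hω0 : 0 < ω := ENNReal.toReal_pos (Metric.measure_ball_pos _ _ one_pos).ne'
    measure_ball_lt_top.ne
  have hz0 : 0 < z := ENNReal.toReal_pos partition_ne_zero partition_ne_top
  set c₁ := 2 * 2 ^ s / ω with hc₁
  set c₂ := 2 * z ^ 2 / ω ^ 2 with hc₂
  set c₃ := 2 * Real.exp w₁ / ω with hc₃
  set c₄ := 2 * Real.exp w₁ ^ 2 * z ^ 2 / ω ^ 2 with hc₄
  have hc₁0 : 0 < c₁ := by positivity
  have hc₂0 : 0 < c₂ := by positivity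
  have hc₃0 : 0 < c₃ := by positivity
  have hc₄0 : 0 < c₄ := by positivity
  refine ⟨c₁ + c₂ + c₃ + c₄, by positivity, fun δ R w S hδ hδR hw hS0 hS f hf => ?_⟩
  have hfm : Measurable f := (Lp.stronglyMeasurable f).measurable
  set M := ∫ x, |f x| ∂(gibbs V) with hM
  have hE0 : 0 ≤ form α V f f := integral_nonneg fun p => kernel_self_nonneg _ p
  have hMt : (∫⁻ x, ‖f x‖ₑ ∂gibbs V).toReal = M :=
    (integral_norm_eq_lintegral_enorm (Lp.aestronglyMeasurable f)).symm
  have hMf : ∫⁻ x, ‖f x‖ₑ ∂gibbs V ≠ ∞ := ((Lp.memLp f).integrable (by norm_num)).2.ne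
  have hEt : (∫⁻ p, ENNReal.ofReal (kernel α f f p) ∂(gibbs V).prod volume).toReal =
      form α V f f := by
    rw [form, integral_eq_lintegral_of_nonneg_ae (ae_of_all _ fun p => kernel_self_nonneg _ p)
      (measurable_kernel hfm).aestronglyMeasurable]
  have hEf : ∫⁻ p, ENNReal.ofReal (kernel α f f p) ∂(gibbs V).prod volume ≠ ∞ :=
    Integrable.lintegral_lt_top hf |>.ne
  have hvol : volume (Metric.ball (0 : EuclideanSpace ℝ (Fin d)) δ) =
      ENNReal.ofReal (δ ^ d) * volume (Metric.ball (0 : EuclideanSpace ℝ (Fin d)) 1) := by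
    rw [Measure.addHaar_ball_of_pos _ _ hδ, finrank_euclideanSpace_fin]
  have hball : ∀ r : ℝ, volume (Metric.ball (0 : EuclideanSpace ℝ (Fin d)) r) ≠ ∞ :=
    fun r => measure_ball_lt_top.ne
  have h1 := mul_sq_le_of_ennreal (setLIntegral_closedBall_le hα₀ hV hfm hδ hδR hw) (hball _)
    ENNReal.ofReal_ne_top hEf ENNReal.ofReal_ne_top partition_ne_top hMf
  have h2 := mul_sq_le_of_ennreal (setLIntegral_compl_closedBall_le hα₀ hV hfm hw₁ hS0 hS) (hball _)
    ENNReal.ofReal_ne_top hEf ENNReal.ofReal_ne_top partition_ne_top hMf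
  rw [← integral_sq_eq_toReal hfm, hEt, hMt, ← hz, ← hω,
    ENNReal.toReal_ofReal (by positivity), ENNReal.toReal_ofReal (by positivity)] at h2
  rw [← integral_sq_eq_toReal hfm, hEt, hMt, ← hs, ← hz, hvol, ENNReal.toReal_mul, ← hω,
    ENNReal.toReal_ofReal (by positivity), ENNReal.toReal_ofReal (by positivity),
    ENNReal.toReal_ofReal (by positivity)] at h1
  have hsplit := integral_add_compl
    (Metric.isClosed_closedBall (x := (0 : EuclideanSpace ℝ (Fin d))) (ε := R)).measurableSet
    (Lp.memLp f).integrable_sq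
  rw [← hsplit]
  set I₁ := ∫ x in Metric.closedBall 0 R, f x ^ 2 ∂(gibbs V)
  set I₂ := ∫ x in (Metric.closedBall 0 R)ᶜ, f x ^ 2 ∂(gibbs V)
  set E := form α V f f
  have hpow : (2 * δ) ^ s = 2 ^ s * (δ ^ α * δ ^ d) := by
    rw [Real.mul_rpow (by norm_num) hδ.le, hs, Real.rpow_add hδ, Real.rpow_natCast]
    ring
  have h3 : I₁ ≤ c₁ * δ ^ α * E + c₂ * (Real.exp w / δ ^ d) ^ 2 * M ^ 2 := by
    rw [hpow, ← le_div_iff₀ (by positivity)] at h1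
    refine h1.trans_eq ?_
    rw [hc₁, hc₂]
    field_simp
  have h4 : I₂ ≤ c₃ * S * E + c₄ * M ^ 2 := by
    rw [← le_div_iff₀ (by positivity)] at h2
    refine h2.trans_eq ?_
    rw [hc₃, hc₄]
    field_simp
  have hδα : 0 ≤ δ ^ α := by positivity
  have h5 : c₁ * δ ^ α + c₃ * S ≤ (c₁ + c₂ + c₃ + c₄) * (δ ^ α + S) := by
    nlinarith [mul_nonneg hc₁0.le hS0, mul_nonneg hc₂0.le hS0, mul_nonneg hc₄0.le hS0,
      mul_nonneg hc₂0.le hδα, mul_nonneg hc₃0.le hδα, mul_nonneg hc₄0.le hδα]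
  have h6 : c₂ * (Real.exp w / δ ^ d) ^ 2 + c₄ ≤
      (c₁ + c₂ + c₃ + c₄) * (1 + (Real.exp w / δ ^ d) ^ 2) := by
    have hq := sq_nonneg (Real.exp w / δ ^ d)
    nlinarith [mul_nonneg hc₁0.le hq, mul_nonneg hc₃0.le hq, mul_nonneg hc₄0.le hq]
  have h7 := mul_le_mul_of_nonneg_right h5 hE0
  have h8 := mul_le_mul_of_nonneg_right h6 (sq_nonneg M)
  linarith

end StableLike

end

noncomputable section

namespace StableLike

variable {d : ℕ} {α : ℝ} {W : ℝ → ℝ}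

/-- `W` is the profile of a radial potential `x ↦ W(|x|)`: it is continuous, nondecreasing on
`[0, ∞)`, and grows faster than any multiple of the logarithm. -/
structure IsRadialProfile (W : ℝ → ℝ) : Prop where
  continuous : Continuous W
  monotone : MonotoneOn W (Set.Ici 0)
  growth : ∀ N : ℝ, 0 ≤ N → ∃ C : ℝ, ∀ s, 0 ≤ s → N * Real.log (1 + s) ≤ W s + C

theorem IsRadialProfile.isProbabilityMeasure_gibbs (hW : IsRadialProfile W) (d : ℕ) :
    IsProbabilityMeasure (gibbs fun x : EuclideanSpace ℝ (Fin d) => W ‖x‖) := by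
  have hm : Measurable fun x : EuclideanSpace ℝ (Fin d) =>
      ENNReal.ofReal (Real.exp (-W ‖x‖)) := by
    have := hW.continuous.measurable
    fun_prop
  obtain ⟨C, hC⟩ := hW.growth (d + 1) (by positivity)
  have hint : Integrable fun x : EuclideanSpace ℝ (Fin d) =>
      Real.exp C * (1 + ‖x‖) ^ (-((d : ℝ) + 1)) :=
    (integrable_one_add_norm (by rw [finrank_euclideanSpace_fin]; linarith)).const_mul _
  have hle : ∀ x : EuclideanSpace ℝ (Fin d), Real.exp (-W ‖x‖) ≤
      Real.exp C * (1 + ‖x‖) ^ (-((d : ℝ) + 1)) := by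
    intro x
    have h1 : 0 < 1 + ‖x‖ := by positivity
    rw [Real.rpow_def_of_pos h1, ← Real.exp_add]
    refine Real.exp_le_exp.2 ?_
    have := hC ‖x‖ (norm_nonneg x)
    linarith
  have htop : ∫⁻ x : EuclideanSpace ℝ (Fin d), ENNReal.ofReal (Real.exp (-W ‖x‖)) ≠ ∞ :=
    ((lintegral_mono fun x => ENNReal.ofReal_le_ofReal (hle x)).trans_lt
      hint.lintegral_lt_top).ne
  have hzero : ∫⁻ x : EuclideanSpace ℝ (Fin d), ENNReal.ofReal (Real.exp (-W ‖x‖)) ≠ 0 := by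
    rw [Ne, lintegral_eq_zero_iff hm]
    intro h
    have h2 : ∀ᵐ x : EuclideanSpace ℝ (Fin d), False := by
      filter_upwards [h] with x hx
      simp only [Pi.zero_apply, ENNReal.ofReal_eq_zero] at hx
      exact absurd (Real.exp_pos _) (not_lt.2 hx)
    exact h2.exists.choose_spec
  refine ⟨?_⟩
  rw [gibbs, Measure.smul_apply, withDensity_apply _ MeasurableSet.univ, setLIntegral_univ,
    smul_eq_mul, ENNReal.inv_mul_cancel hzero htop]

/-- Choice of the truncation radius: the largest `R` with `W(R) - k log(1 + R) ≤ L`. -/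
theorem IsRadialProfile.exists_radius (hW : IsRadialProfile W) {k : ℝ} (hk : 0 ≤ k) {L : ℝ}
    (hL : W 1 - k * Real.log 2 ≤ L) :
    ∃ R, 1 ≤ R ∧ W R - k * Real.log (1 + R) ≤ L ∧
      ∀ s, R < s → L < W s - k * Real.log (1 + s) := by
  obtain ⟨C, hC⟩ := hW.growth (k + 1) (by linarith)
  set A := {R : ℝ | 1 ≤ R ∧ W R - k * Real.log (1 + R) ≤ L} with hA
  have hne : A.Nonempty := ⟨1, le_rfl, by norm_num; linarith⟩
  have hbdd : BddAbove A := by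
    refine ⟨Real.exp (L + C), fun R hR => ?_⟩
    have h1 := hC R (by linarith [hR.1])
    have h2 : Real.log (1 + R) ≤ L + C := by linarith [hR.2]
    have h3 : 0 < 1 + R := by linarith [hR.1]
    rw [Real.log_le_iff_le_exp h3] at h2
    linarith
  have hclosed : IsClosed A := by
    have hcont : ContinuousOn (fun R => W R - k * Real.log (1 + R)) (Set.Ici 1) := by
      refine hW.continuous.continuousOn.sub (ContinuousOn.mul continuousOn_const
        (ContinuousOn.log (by fun_prop) fun x hx => ?_))
      have := Set.mem_Ici.1 hx
      positivity
    exact hcont.preimage_isClosed_of_isClosed isClosed_Ici isClosed_Iic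
  have hmem := hclosed.csSup_mem hne hbdd
  refine ⟨sSup A, hmem.1, hmem.2, fun s hs => ?_⟩
  by_contra! h
  exact absurd (le_csSup hbdd ⟨hmem.1.trans hs.le, h⟩) (not_le.2 hs)

theorem IsRadialProfile.exists_small_superPoincare (hW : IsRadialProfile W) (hα₀ : 0 < α) :
    ∃ C B r₁ : ℝ, 0 < C ∧ 0 < B ∧ 0 < r₁ ∧ r₁ ≤ 1 ∧ ∀ r, 0 < r → r ≤ r₁ → ∃ R, 1 ≤ R ∧
      W R ≤ B * Real.log (1 + r⁻¹) ∧
      ∀ f ∈ formDomain α (fun x : EuclideanSpace ℝ (Fin d) => W ‖x‖),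
        ∫ x, f x ^ 2 ∂(gibbs fun x : EuclideanSpace ℝ (Fin d) => W ‖x‖) ≤
          r * form α (fun x : EuclideanSpace ℝ (Fin d) => W ‖x‖) f f +
          C * (1 + r ^ (-(2 * (α + d) / α)) * (1 + R) ^ (2 * (d + α))) *
            (∫ x, |f x| ∂(gibbs fun x : EuclideanSpace ℝ (Fin d) => W ‖x‖)) ^ 2 := by
  have := hW.isProbabilityMeasure_gibbs d
  have hV : Measurable fun x : EuclideanSpace ℝ (Fin d) => W ‖x‖ :=
    (hW.continuous.comp continuous_norm).measurable
  set k := (d : ℝ) + α with hk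
  have hk0 : 0 < k := by positivity
  obtain ⟨C, hC0, hC⟩ := exists_integral_sq_le hα₀ hV (w₁ := W 1) fun y hy =>
    hW.monotone (norm_nonneg y) (Set.mem_Ici.2 zero_le_one) hy
  obtain ⟨C', hC'⟩ := hW.growth (2 * k) (by positivity)
  set b := |2 * Real.log (2 * C) + C'| with hb
  have hlog2 : 0 < Real.log 2 := Real.log_pos one_lt_two
  refine ⟨C * max 1 ((2 * C) ^ (2 * (α + d) / α)), 2 + b / Real.log 2,
    min 1 (min (2 * C) (2 * C * Real.exp (-(W 1 - k * Real.log 2)))),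
    by positivity, by positivity, by positivity, min_le_left _ _, fun r hr hr₁ => ?_⟩
  have hr1 : r ≤ 1 := hr₁.trans (min_le_left _ _)
  have hr2 : r ≤ 2 * C := hr₁.trans ((min_le_right _ _).trans (min_le_left _ _))
  have hr3 : r ≤ 2 * C * Real.exp (-(W 1 - k * Real.log 2)) :=
    hr₁.trans ((min_le_right _ _).trans (min_le_right _ _))
  set L := Real.log (2 * C / r) with hL
  have h2Cr : 0 < 2 * C / r := by positivity
  have hL1 : W 1 - k * Real.log 2 ≤ L := by
    rw [hL, Real.le_log_iff_exp_le h2Cr, le_div_iff₀ hr]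
    have := mul_le_mul_of_nonneg_left hr3 (Real.exp_pos (W 1 - k * Real.log 2)).le
    refine this.trans_eq ?_
    rw [mul_left_comm, ← Real.exp_add, add_neg_cancel, Real.exp_zero, mul_one]
  obtain ⟨R, hR1, hR2, hR3⟩ := hW.exists_radius hk0.le hL1
  have h1R : 0 < 1 + R := by linarith
  refine ⟨R, hR1, ?_, ?_⟩
  · have h1 := hC' R (by linarith)
    have h2 : W R ≤ 2 * L + C' := by linarith
    have h3 : Real.log 2 ≤ Real.log (1 + r⁻¹) := by
      refine Real.log_le_log two_pos ?_
      have := (one_le_inv₀ hr).2 hr1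
      linarith
    have h4 : -Real.log r ≤ Real.log (1 + r⁻¹) := by
      rw [← Real.log_inv]
      exact Real.log_le_log (by positivity) (by linarith)
    have h5 : L = Real.log (2 * C) - Real.log r := Real.log_div (by positivity) hr.ne'
    have h6 : b ≤ b / Real.log 2 * Real.log (1 + r⁻¹) := by
      rw [div_mul_eq_mul_div, le_div_iff₀ hlog2]
      exact mul_le_mul_of_nonneg_left h3 (abs_nonneg _)
    have h7 : 2 * Real.log (2 * C) + C' ≤ b := le_abs_self _
    linarith
  · intro f hf
    set δ := (r / (2 * C)) ^ (1 / α) with hδ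
    have hrC : 0 < r / (2 * C) := by positivity
    have hδ0 : 0 < δ := Real.rpow_pos_of_pos hrC _
    have hδ1 : δ ≤ 1 := Real.rpow_le_one hrC.le ((div_le_one (by positivity)).2 hr2) (by positivity)
    have hδα : δ ^ α = r / (2 * C) := by
      rw [hδ, ← Real.rpow_mul hrC.le, one_div_mul_cancel hα₀.ne', Real.rpow_one]
    have hmain := hC δ R (W R) (r / (2 * C)) hδ0 (hδ1.trans hR1)
      (fun y hy => hW.monotone (norm_nonneg y) (by simp; linarith) hy) hrC.le
      (fun x hx => by
        have h1 := hR3 _ hx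
        have h2 : 0 < 1 + ‖x‖ := by positivity
        rw [Real.rpow_def_of_pos h2, ← Real.exp_add]
        calc _ ≤ Real.exp (-L) := Real.exp_le_exp.2 (by linarith)
          _ = r / (2 * C) := by rw [hL, Real.exp_neg, Real.exp_log h2Cr, inv_div]) f hf
    have e1 : C * (δ ^ α + r / (2 * C)) = r := by rw [hδα]; field_simp; ring
    rw [e1] at hmain
    refine hmain.trans (add_le_add le_rfl (mul_le_mul_of_nonneg_right ?_ (sq_nonneg _)))
    set p := 2 * (α + d) / α with hp
    have hexp : Real.exp (W R) ≤ 2 * C / r * (1 + R) ^ k := by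
      rw [Real.rpow_def_of_pos h1R, ← Real.exp_log h2Cr, ← Real.exp_add]
      exact Real.exp_le_exp.2 (by linarith)
    have hδd : δ ^ d = (2 * C / r) ^ (-(d / α) : ℝ) := by
      rw [hδ, ← Real.rpow_mul_natCast hrC.le, ← inv_div, Real.inv_rpow h2Cr.le,
        ← Real.rpow_neg h2Cr.le]
      congr 1
      ring
    have hq : (Real.exp (W R) / δ ^ d) ^ 2 ≤ (2 * C) ^ p * (r ^ (-p) * (1 + R) ^ (2 * k)) := by
      calc _ ≤ (2 * C / r * (1 + R) ^ k / δ ^ d) ^ 2 := by gcongr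
        _ = ((2 * C / r) ^ (1 + d / α) * (1 + R) ^ k) ^ 2 := by
          rw [hδd, Real.rpow_neg h2Cr.le, div_inv_eq_mul, Real.rpow_add h2Cr, Real.rpow_one]
          ring
        _ = (2 * C / r) ^ p * (1 + R) ^ (2 * k) := by
          rw [mul_pow, ← Real.rpow_mul_natCast h2Cr.le, ← Real.rpow_mul_natCast h1R.le]
          congr 2
          · rw [hp]; field_simp; push_cast; ring
          · push_cast; ring
        _ = _ := by
          rw [Real.div_rpow (by positivity) hr.le, Real.rpow_neg hr.le]
          ring
    have hx : 0 ≤ r ^ (-p) * (1 + R) ^ (2 * k) := by positivity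
    rw [mul_assoc]
    refine mul_le_mul_of_nonneg_left ?_ hC0.le
    rw [mul_add]
    refine add_le_add (by simp) (hq.trans ?_)
    exact mul_le_mul_of_nonneg_right (le_max_right _ _) hx

/-- The super Poincaré inequality for a radial potential, for any family of rates that dominates
the rate obtained at the optimal truncation radius. -/
theorem IsRadialProfile.exists_superPoincare (hW : IsRadialProfile W) (hα₀ : 0 < α)
    {rate : ℝ → ℝ → ℝ} (hle : ∀ c r, 0 < c → 0 < r → c ≤ rate c r)
    (hrate : ∀ B C : ℝ, 0 < B → 0 < C → ∃ K, ∀ c r R, K ≤ c → 0 < r → r ≤ 1 → 1 ≤ R →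
      W R ≤ B * Real.log (1 + r⁻¹) →
      C * (1 + r ^ (-(2 * (α + d) / α)) * (1 + R) ^ (2 * (d + α))) ≤ rate c r) :
    ∃ c, 0 < c ∧ SuperPoincare α (fun x : EuclideanSpace ℝ (Fin d) => W ‖x‖) (rate c) := by
  obtain ⟨C, B, r₁, hC0, hB0, hr₁0, hr₁1, h⟩ :=
    hW.exists_small_superPoincare (d := d) hα₀
  obtain ⟨K, hK⟩ := hrate B C hB0 hC0
  obtain ⟨R₁, hR₁1, hR₁W, hR₁⟩ := h r₁ hr₁0 le_rfl
  set β₁ := C * (1 + r₁ ^ (-(2 * (α + d) / α)) * (1 + R₁) ^ (2 * (d + α))) with hβ₁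
  have hc : 0 < max 1 (max K β₁) := lt_of_lt_of_le one_pos (le_max_left _ _)
  refine ⟨max 1 (max K β₁), hc, fun r hr f hf => ?_⟩
  rcases le_total r r₁ with hrr | hrr
  · obtain ⟨R, hR1, hRW, hR⟩ := h r hr hrr
    refine (hR f hf).trans ?_
    gcongr
    exact hK _ r R ((le_max_left _ _).trans (le_max_right _ _)) hr (hrr.trans hr₁1) hR1 hRW
  · have hE0 : 0 ≤ form α (fun x : EuclideanSpace ℝ (Fin d) => W ‖x‖) f f :=
      integral_nonneg fun p => kernel_self_nonneg _ p
    refine (hR₁ f hf).trans ?_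
    gcongr
    exact ((le_max_right _ _).trans (le_max_right _ _)).trans (hle _ r hc hr)

end StableLike

end

noncomputable section

namespace StableLike

theorem one_add_sq_ge {s : ℝ} : 1 + s ≤ 2 * (1 + s ^ 2) := by
  nlinarith [sq_nonneg (s - 1), sq_nonneg s]

theorem log_one_add_le {s : ℝ} (hs : 0 ≤ s) :
    Real.log (1 + s) ≤ Real.log 2 + Real.log (1 + s ^ 2) := by
  rw [← Real.log_mul (by norm_num) (by positivity)]
  exact Real.log_le_log (by positivity) one_add_sq_ge

theorem one_add_rpow_le {R k : ℝ} (hR : 1 ≤ R) (hk : 0 ≤ k) :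
    (1 + R) ^ (2 * k) ≤ 2 ^ k * (1 + R ^ 2) ^ k := by
  rw [Real.rpow_mul (by linarith), ← Real.mul_rpow (by norm_num) (by positivity)]
  refine Real.rpow_le_rpow (by positivity) ?_ hk
  rw [Real.rpow_two]
  nlinarith [sq_nonneg (R - 1)]

theorem isRadialProfile_log {ε : ℝ} (hε : 0 < ε) :
    IsRadialProfile fun s => Real.log (1 + s ^ 2) ^ (1 + ε) where
  continuous := by
    refine Continuous.rpow_const (Continuous.log (by fun_prop) fun s => by positivity) fun s => ?_
    exact Or.inr (by linarith)
  monotone := fun s hs t _ hst => by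
    have hs : 0 ≤ s := hs
    have h0 : 0 ≤ Real.log (1 + s ^ 2) := Real.log_nonneg (by nlinarith)
    have h1 : Real.log (1 + s ^ 2) ≤ Real.log (1 + t ^ 2) :=
      Real.log_le_log (by positivity) (by gcongr)
    exact Real.rpow_le_rpow h0 h1 (by linarith)
  growth := fun N hN => by
    refine ⟨N * Real.log 2 + N * N ^ (1 / ε), fun s hs => ?_⟩
    have h1 := mul_le_mul_of_nonneg_left (log_one_add_le hs) hN
    have h0 : 0 ≤ Real.log (1 + s ^ 2) := Real.log_nonneg (by nlinarith)
    set u := Real.log (1 + s ^ 2) with hu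
    have h3 : 0 ≤ N * N ^ (1 / ε) := by positivity
    have h2 : N * u ≤ u ^ (1 + ε) + N * N ^ (1 / ε) := by
      rcases le_total u (N ^ (1 / ε)) with h | h
      · have := mul_le_mul_of_nonneg_left h hN
        have := Real.rpow_nonneg h0 (1 + ε)
        linarith
      · have h4 : N ≤ u ^ ε := by
          have := Real.rpow_le_rpow (by positivity) h hε.le
          rwa [← Real.rpow_mul hN, one_div_mul_cancel hε.ne', Real.rpow_one] at this
        rw [Real.rpow_add_of_nonneg h0 zero_le_one hε.le, Real.rpow_one]
        nlinarith
    linarith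

theorem isRadialProfile_pow {ε : ℝ} (hε : 0 < ε) :
    IsRadialProfile fun s => (1 + s ^ 2) ^ ε where
  continuous := by
    refine Continuous.rpow_const (by fun_prop) fun s => ?_
    exact Or.inr hε.le
  monotone := fun s hs t _ hst => by
    have hs : 0 ≤ s := hs
    exact Real.rpow_le_rpow (by positivity) (by gcongr) hε.le
  growth := fun N hN => by
    refine ⟨N * Real.log 2 + (N * (2 / ε)) ^ 2, fun s hs => ?_⟩
    have h1 := mul_le_mul_of_nonneg_left (log_one_add_le hs) hN
    have h2 := Real.log_le_rpow_div (x := 1 + s ^ 2) (by positivity) (half_pos hε)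
    have h3 : (1 + s ^ 2) ^ ε = ((1 + s ^ 2) ^ (ε / 2)) ^ 2 := by
      rw [← Real.rpow_mul_natCast (by positivity)]
      congr 1
      push_cast
      ring
    rw [h3]
    set v := (1 + s ^ 2) ^ (ε / 2)
    have h4 := mul_le_mul_of_nonneg_left h2 hN
    have h5 : N * (v / (ε / 2)) = N * (2 / ε) * v := by field_simp
    nlinarith [sq_nonneg (N * (2 / ε) - v), sq_nonneg (N * (2 / ε)), sq_nonneg v]

theorem log_one_add_inv_nonneg {r : ℝ} (hr : 0 < r) : 0 ≤ Real.log (1 + r⁻¹) :=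
  Real.log_nonneg (by have := inv_pos.2 hr; linarith)

theorem log_two_le_log_one_add_inv {r : ℝ} (hr : 0 < r) (hr1 : r ≤ 1) :
    Real.log 2 ≤ Real.log (1 + r⁻¹) := by
  refine Real.log_le_log two_pos ?_
  have := (one_le_inv₀ hr).2 hr1
  linarith

section LogRate

variable {d : ℕ} {α ε : ℝ}

theorem le_logRate {c r : ℝ} (hc : 0 < c) (hr : 0 < r) : c ≤ logRate d α ε c r := by
  rw [logRate]
  have : 0 ≤ c * r ^ (-(2 * (α + d) / α)) *
    Real.exp (c * Real.log (1 + r⁻¹) ^ (1 / (1 + ε))) := by positivity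
  linarith

theorem mul_logRate_le {C c r : ℝ} (hC : 1 ≤ C) (hc : 0 < c) (hr : 0 < r) :
    C * logRate d α ε c r ≤ logRate d α ε (C * c) r := by
  have h0 := Real.rpow_nonneg (log_one_add_inv_nonneg hr) (1 / (1 + ε))
  have h1 : c ≤ C * c := le_mul_of_one_le_left hc.le hC
  rw [logRate, logRate, mul_add]
  refine add_le_add le_rfl ?_
  rw [← mul_assoc, ← mul_assoc]
  gcongr

theorem logRate_half_le (hα₀ : 0 < α) (hε : 0 < ε) {c r : ℝ} (hc : 0 < c) (hr : 0 < r) :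
    logRate d α ε c (r / 2) ≤
      2 ^ (2 * (α + d) / α) * Real.exp (c * Real.log 2 ^ (1 / (1 + ε))) * logRate d α ε c r := by
  set p := 2 * (α + d) / α with hp
  set a := 1 / (1 + ε) with ha
  have ha0 : 0 < a := by positivity
  have ha1 : a ≤ 1 := by
    rw [ha, div_le_one (by linarith)]; linarith
  have hp0 : 0 < p := by positivity
  have hlog2 : 0 < Real.log 2 := Real.log_pos one_lt_two
  have h1 : Real.log (1 + (r / 2)⁻¹) ^ a ≤ Real.log 2 ^ a + Real.log (1 + r⁻¹) ^ a := by
    have h2 : Real.log (1 + (r / 2)⁻¹) ≤ Real.log 2 + Real.log (1 + r⁻¹) := by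
      rw [← Real.log_mul (by norm_num) (by positivity)]
      refine Real.log_le_log (by positivity) ?_
      rw [inv_div, div_eq_mul_inv]
      linarith
    exact (Real.rpow_le_rpow (log_one_add_inv_nonneg (by positivity)) h2 ha0.le).trans
      (Real.rpow_add_le_add_rpow hlog2.le (log_one_add_inv_nonneg hr) ha0.le ha1)
  have h3 : (r / 2) ^ (-p) = 2 ^ p * r ^ (-p) := by
    rw [Real.div_rpow hr.le (by norm_num), Real.rpow_neg two_pos.le, div_inv_eq_mul, mul_comm]
  have h4 : Real.exp (c * Real.log (1 + (r / 2)⁻¹) ^ a) ≤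
      Real.exp (c * Real.log 2 ^ a) * Real.exp (c * Real.log (1 + r⁻¹) ^ a) := by
    rw [← Real.exp_add, ← mul_add]
    gcongr
  have h5 : 1 ≤ 2 ^ p * Real.exp (c * Real.log 2 ^ a) :=
    one_le_mul_of_one_le_of_one_le (Real.one_le_rpow (by norm_num) hp0.le)
      (Real.one_le_exp (by positivity))
  rw [logRate, logRate, ← hp, ← ha, mul_add, h3]
  refine add_le_add (le_mul_of_one_le_left hc.le h5) ?_
  calc _ ≤ c * (2 ^ p * r ^ (-p)) *
        (Real.exp (c * Real.log 2 ^ a) * Real.exp (c * Real.log (1 + r⁻¹) ^ a)) := by gcongr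
    _ = _ := by ring

theorem exists_le_logRate (hα₀ : 0 < α) (hε : 0 < ε) (B C : ℝ) (hB : 0 < B) (hC : 0 < C) :
    ∃ K, ∀ c r R, K ≤ c → 0 < r → r ≤ 1 → 1 ≤ R →
      Real.log (1 + R ^ 2) ^ (1 + ε) ≤ B * Real.log (1 + r⁻¹) →
      C * (1 + r ^ (-(2 * (α + d) / α)) * (1 + R) ^ (2 * (d + α))) ≤ logRate d α ε c r := by
  set a := 1 / (1 + ε) with ha
  set k := (d : ℝ) + α with hk
  have hk0 : 0 < k := by positivity
  refine ⟨max C (max (C * 2 ^ k) (k * B ^ a)), fun c r R hc hr _ hR hW => ?_⟩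
  have hc1 : C ≤ c := (le_max_left _ _).trans hc
  have hc2 : C * 2 ^ k ≤ c := ((le_max_left _ _).trans (le_max_right _ _)).trans hc
  have hc3 : k * B ^ a ≤ c := ((le_max_right _ _).trans (le_max_right _ _)).trans hc
  have hℓ := log_one_add_inv_nonneg hr
  set ℓ := Real.log (1 + r⁻¹)
  have hu : 0 ≤ Real.log (1 + R ^ 2) := Real.log_nonneg (by nlinarith)
  have h1 : Real.log (1 + R ^ 2) ≤ B ^ a * ℓ ^ a := by
    have h2 := Real.rpow_le_rpow (by positivity) hW (show 0 ≤ a by positivity)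
    rwa [← Real.rpow_mul hu, ha, mul_one_div_cancel (by positivity), Real.rpow_one, ← ha,
      Real.mul_rpow hB.le hℓ] at h2
  have h2 : (1 + R) ^ (2 * k) ≤ 2 ^ k * Real.exp (c * ℓ ^ a) := by
    refine (one_add_rpow_le hR hk0.le).trans ?_
    gcongr
    rw [Real.rpow_def_of_pos (by positivity)]
    refine Real.exp_le_exp.2 ?_
    calc _ ≤ B ^ a * ℓ ^ a * k := by gcongr
      _ = k * B ^ a * ℓ ^ a := by ring
      _ ≤ c * ℓ ^ a := by gcongr
  rw [logRate, ← ha]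
  set q := r ^ (-(2 * (α + d) / α))
  have hq : 0 < q := Real.rpow_pos_of_pos hr _
  calc C * (1 + q * (1 + R) ^ (2 * k)) ≤ C * (1 + q * (2 ^ k * Real.exp (c * ℓ ^ a))) := by gcongr
    _ = C + C * 2 ^ k * q * Real.exp (c * ℓ ^ a) := by ring
    _ ≤ c + c * q * Real.exp (c * ℓ ^ a) := by gcongr

end LogRate

section PowRate

variable {d : ℕ} {α ε : ℝ}

theorem le_powRate {c r : ℝ} (hc : 0 < c) (hr : 0 < r) : c ≤ powRate d α ε c r := by
  rw [powRate]
  have := Real.rpow_nonneg (log_one_add_inv_nonneg hr) ((2 * α + d) * (d + α) / (2 * ε * α))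
  have h : 0 ≤ r ^ (-(2 * (α + d) / α)) *
    Real.log (1 + r⁻¹) ^ ((2 * α + d) * (d + α) / (2 * ε * α)) := by positivity
  exact le_mul_of_one_le_right hc.le (by linarith)

theorem powRate_half_le (hα₀ : 0 < α) (hε : 0 < ε) {c r : ℝ} (hc : 0 < c) (hr : 0 < r) :
    powRate d α ε c (r / 2) ≤ 2 ^ (2 * (α + d) / α) *
      2 ^ ((2 * α + d) * (d + α) / (2 * ε * α)) * powRate d α ε c r := by
  set p := 2 * (α + d) / α with hp
  set q := (2 * α + d) * (d + α) / (2 * ε * α) with hq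
  have hp0 : 0 < p := by positivity
  have hq0 : 0 < q := by positivity
  have hℓ := log_one_add_inv_nonneg hr
  have h1 : Real.log (1 + (r / 2)⁻¹) ^ q ≤ 2 ^ q * Real.log (1 + r⁻¹) ^ q := by
    rw [← Real.mul_rpow (by norm_num) hℓ]
    refine Real.rpow_le_rpow (log_one_add_inv_nonneg (by positivity)) ?_ hq0.le
    have h2 : (2 : ℝ) * Real.log (1 + r⁻¹) = Real.log ((1 + r⁻¹) ^ 2) := by
      rw [Real.log_pow]; norm_num
    rw [h2]
    refine Real.log_le_log (by positivity) ?_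
    rw [inv_div, div_eq_mul_inv]
    nlinarith [sq_nonneg r⁻¹]
  have h3 : (r / 2) ^ (-p) = 2 ^ p * r ^ (-p) := by
    rw [Real.div_rpow hr.le (by norm_num), Real.rpow_neg two_pos.le, div_inv_eq_mul, mul_comm]
  have h5 : (1 : ℝ) ≤ 2 ^ p * 2 ^ q :=
    one_le_mul_of_one_le_of_one_le (Real.one_le_rpow (by norm_num) hp0.le)
      (Real.one_le_rpow (by norm_num) hq0.le)
  rw [powRate, powRate, ← hp, ← hq, mul_left_comm, h3]
  gcongr
  calc _ ≤ 2 ^ p * 2 ^ q + 2 ^ p * r ^ (-p) * (2 ^ q * Real.log (1 + r⁻¹) ^ q) := by gcongr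
    _ = _ := by ring

theorem exists_le_powRate (hα₀ : 0 < α) (hε : 0 < ε) (B C : ℝ) (hB : 0 < B) (hC : 0 < C) :
    ∃ K, ∀ c r R, K ≤ c → 0 < r → r ≤ 1 → 1 ≤ R →
      (1 + R ^ 2) ^ ε ≤ B * Real.log (1 + r⁻¹) →
      C * (1 + r ^ (-(2 * (α + d) / α)) * (1 + R) ^ (2 * (d + α))) ≤ powRate d α ε c r := by
  set k := (d : ℝ) + α with hk
  have hk0 : 0 < k := by positivity
  have hlog2 : 0 < Real.log 2 := Real.log_pos one_lt_two
  set q := (2 * α + d) * k / (2 * ε * α) with hq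
  have hkq : k / ε - q ≤ 0 := by
    rw [hq, sub_nonpos, div_le_div_iff₀ hε (by positivity)]
    have : 0 ≤ k * ε * d := by positivity
    nlinarith
  set D := 2 ^ k * (B ^ (k / ε) * Real.log 2 ^ (k / ε - q)) with hD
  refine ⟨C * max 1 D, fun c r R hc hr hr1 hR hW => ?_⟩
  have hℓ2 := log_two_le_log_one_add_inv hr hr1
  set ℓ := Real.log (1 + r⁻¹)
  have hℓ : 0 < ℓ := hlog2.trans_le hℓ2
  have h1 : (1 + R ^ 2) ^ k ≤ B ^ (k / ε) * Real.log 2 ^ (k / ε - q) * ℓ ^ q := by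
    have h2 := Real.rpow_le_rpow (by positivity) hW (show 0 ≤ k / ε by positivity)
    rw [← Real.rpow_mul (by positivity), mul_div_cancel₀ _ hε.ne', Real.mul_rpow hB.le hℓ.le] at h2
    refine h2.trans ?_
    rw [mul_assoc]
    gcongr
    calc ℓ ^ (k / ε) = ℓ ^ (k / ε - q) * ℓ ^ q := by rw [← Real.rpow_add hℓ, sub_add_cancel]
      _ ≤ _ := by
        gcongr ?_ * _
        exact Real.rpow_le_rpow_of_nonpos hlog2 hℓ2 hkq
  have h2 : (1 + R) ^ (2 * k) ≤ D * ℓ ^ q := by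
    refine (one_add_rpow_le hR hk0.le).trans ?_
    rw [hD, mul_assoc (2 ^ k)]
    gcongr
  rw [powRate, ← hk, ← hq]
  set y := r ^ (-(2 * (α + d) / α))
  have hy : 0 < y := Real.rpow_pos_of_pos hr _
  have hyℓ : 0 ≤ y * ℓ ^ q := by positivity
  calc C * (1 + y * (1 + R) ^ (2 * k)) ≤ C * (1 + y * (D * ℓ ^ q)) := by gcongr
    _ = C * 1 + C * D * (y * ℓ ^ q) := by ring
    _ ≤ C * max 1 D + C * max 1 D * (y * ℓ ^ q) := by
        gcongr
        · exact le_max_left _ _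
        · exact le_max_right _ _
    _ = C * max 1 D * (1 + y * ℓ ^ q) := by ring
    _ ≤ c * (1 + y * ℓ ^ q) := by gcongr

end PowRate

theorem IsRadialProfile.semigroup_bound {d : ℕ} (hd : 0 < d) {α : ℝ} (hα₀ : 0 < α) (hα₂ : α < 2)
    {W : ℝ → ℝ} (hW : IsRadialProfile W) {rate : ℝ → ℝ → ℝ}
    (hle : ∀ c r, 0 < c → 0 < r → c ≤ rate c r)
    (hrate : ∀ B C : ℝ, 0 < B → 0 < C → ∃ K, ∀ c r R, K ≤ c → 0 < r → r ≤ 1 → 1 ≤ R →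
      W R ≤ B * Real.log (1 + r⁻¹) →
      C * (1 + r ^ (-(2 * (α + d) / α)) * (1 + R) ^ (2 * (d + α))) ≤ rate c r)
    (hmul : ∀ C c r, 1 ≤ C → 0 < c → 0 < r → C * rate c r ≤ rate (C * c) r)
    (hhalf : ∀ c, 0 < c → ∃ D, ∀ r, 0 < r → rate c (r / 2) ≤ D * rate c r)
    {V : EuclideanSpace ℝ (Fin d) → ℝ} (hV : V = fun x => W ‖x‖) :
    IsProbabilityMeasure (gibbs V) ∧ (∃ c : ℝ, 0 < c ∧ SuperPoincare α V (rate c)) ∧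
      (∃! P, IsAssociatedSemigroup α V P) ∧
      ∃ K : ℝ, 0 < K ∧ ∀ P, IsAssociatedSemigroup α V P → ∀ t : ℝ≥0, 0 < t →
        normL1Linf (P t) ≤ ENNReal.ofReal (rate K t) := by
  subst hV
  have hprob := hW.isProbabilityMeasure_gibbs d
  have hVm : Measurable fun x : EuclideanSpace ℝ (Fin d) => W ‖x‖ :=
    (hW.continuous.comp continuous_norm).measurable
  have hdense := dense_diffOp_domain hd hα₀ hα₂ hVm
  obtain ⟨c, hc, hsp⟩ := hW.exists_superPoincare hα₀ hle hrate
  refine ⟨hprob, ⟨c, hc, hsp⟩, existsUnique_isAssociatedSemigroup hVm hdense, ?_⟩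
  have hnonneg : ∀ r, 0 < r → 0 ≤ rate c r := fun r hr => hc.le.trans (hle c r hc hr)
  obtain ⟨D, hD⟩ := hhalf c hc
  obtain ⟨C, hC1, hC⟩ := exists_normL1Linf_le hVm hdense hsp hnonneg (le_max_left 1 D)
    fun r hr => (hD r hr).trans (mul_le_mul_of_nonneg_right (le_max_right _ _) (hnonneg r hr))
  refine ⟨C * c, by positivity, fun P hP t ht => (hC P hP t ht).trans ?_⟩
  exact ENNReal.ofReal_le_ofReal (hmul C c t hC1 hc (NNReal.coe_pos.2 ht))

end StableLike

end

theorem corollary1p5 (d : ℕ) (hd : 0 < d) (α : ℝ) (hα₀ : 0 < α) (hα₂ : α < 2)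
    (ε : ℝ) (hε : 0 < ε) :
    (IsProbabilityMeasure (StableLike.gibbs (StableLike.logPotential d ε)) ∧
      (∃ c : ℝ, 0 < c ∧
        StableLike.SuperPoincare α (StableLike.logPotential d ε) (StableLike.logRate d α ε c)) ∧
      (∃! P, StableLike.IsAssociatedSemigroup α (StableLike.logPotential d ε) P) ∧
      ∃ K : ℝ, 0 < K ∧ ∀ P, StableLike.IsAssociatedSemigroup α (StableLike.logPotential d ε) P →
        ∀ t : ℝ≥0, 0 < t →
          StableLike.normL1Linf (P t) ≤ ENNReal.ofReal (StableLike.logRate d α ε K t)) ∧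
    (IsProbabilityMeasure (StableLike.gibbs (StableLike.powPotential d ε)) ∧
      (∃ c : ℝ, 0 < c ∧
        StableLike.SuperPoincare α (StableLike.powPotential d ε) (StableLike.powRate d α ε c)) ∧
      (∃! P, StableLike.IsAssociatedSemigroup α (StableLike.powPotential d ε) P) ∧
      ∃ K : ℝ, 0 < K ∧ ∀ P, StableLike.IsAssociatedSemigroup α (StableLike.powPotential d ε) P →
        ∀ t : ℝ≥0, 0 < t →
          StableLike.normL1Linf (P t) ≤ ENNReal.ofReal (StableLike.powRate d α ε K t)) :=
  ⟨(StableLike.isRadialProfile_log hε).semigroup_bound hd hα₀ hα₂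
      (fun _ _ => StableLike.le_logRate) (StableLike.exists_le_logRate hα₀ hε)
      (fun _ _ _ => StableLike.mul_logRate_le)
      (fun _ hc => ⟨_, fun _ => StableLike.logRate_half_le hα₀ hε hc⟩) rfl,
    (StableLike.isRadialProfile_pow hε).semigroup_bound hd hα₀ hα₂
      (fun _ _ => StableLike.le_powRate) (StableLike.exists_le_powRate hα₀ hε)
      (fun _ _ _ _ _ _ => (mul_assoc _ _ _).ge)
      (fun _ hc => ⟨_, fun _ => StableLike.powRate_half_le hα₀ hε hc⟩) rfl⟩
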